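/- Let $\Theta\in\mathbb{C}$ be a root of $f(x)=x^3-27x^2+26x-1$ and let $R=\mathbb{Z}[\Theta]$. Call nonzero ideals $I,J$ of $R$ equivalent if $\alpha I=\beta J$ for some nonzero $\alpha,\beta\in R$; let $[I]$ denote the class of $I$, and let $C(R)$ be the ideal class monoid, i.e. the set of these classes with multiplication $[I][J]=[IJ]$. An ideal $I$ is invertible if $IJ$ is a nonzero principal ideal for some ideal $J$; the classes of the invertible ideals form the Picard group $\operatorname{Pic}(R)\subseteq C(R)$. **Theorem.** The monoid $C(R)$ consists of exactly the following seven, pairwise distinct, elements: $$I_0=[\langle\Theta-2,7\rangle],\quad I_1=[\langle\Theta-7,17\rangle],\quad I_2=[\langle\Theta-4,5\rangle],\quad I_3=[\langle\Theta-11,13\rangle],$$ $$I_4=[\langle\Theta-10,11\rangle],\quad I_5=[\langle\Theta-14,19\rangle],\quad I_6=[\langle\Theta-1,1\rangle].$$ Its multiplication table is given by $I_iI_j=I_k$ for $1\le i,j\le 6$, where $k\in\{1,\dots,6\}$ and $k\equiv i+j\pmod 6$, and $I_0I_i=I_iI_0=I_0$ for $0\le i\le 6$. Moreover $\operatorname{Pic}(R)=\{I_1,\dots,I_6\}$,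 which is isomorphic to $\mathbb{Z}/6\mathbb{Z}$ and generated by $I_1$. The ideal $\langle\Theta-2,7\rangle$ is not invertible, and its class $I_0$ is absorbing: $I_0x=I_0$ for all $x\in C(R)$; in particular $I_0^2=I_0$. -/

import Mathlib

open Polynomial

namespace IdealClasses

section General

/-- The multiplicative monoid of nonzero ideals of an integral domain `R`. -/
def nonzeroIdeals (R : Type*) [CommRing R] [IsDomain R] : Submonoid (Ideal R) where
  carrier := {I | I ≠ ⊥}
  mul_mem' := fun hI hJ h => (Ideal.mul_eq_bot.mp h).elim hI hJ
  one_mem' := one_ne_zero (α := Ideal R)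

/-- The relation `I ≈ J` on nonzero ideals: `α I = β J` for some nonzero `α, β ∈ R`.
It is an equivalence relation compatible with multiplication. -/
def idealCon (R : Type*) [CommRing R] [IsDomain R] : Con (nonzeroIdeals R) where
  r I J := ∃ α β : R, α ≠ 0 ∧ β ≠ 0 ∧
    Ideal.span {α} * (I : Ideal R) = Ideal.span {β} * (J : Ideal R)
  iseqv :=
    { refl := fun _ => ⟨1, 1, one_ne_zero, one_ne_zero, rfl⟩
      symm := fun ⟨α, β, hα, hβ, h⟩ => ⟨β, α, hβ, hα, h.symm⟩
      trans := by
        rintro I J K ⟨α, β, hα, hβ, h⟩ ⟨γ, δ, hγ, hδ, h'⟩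
        refine ⟨γ * α, β * δ, mul_ne_zero hγ hα, mul_ne_zero hβ hδ, ?_⟩
        rw [← Ideal.span_singleton_mul_span_singleton,
          ← Ideal.span_singleton_mul_span_singleton, mul_assoc, h, mul_assoc, ← h',
          mul_left_comm] }
  mul' := by
    rintro I J K L ⟨α, β, hα, hβ, h⟩ ⟨γ, δ, hγ, hδ, h'⟩
    refine ⟨α * γ, β * δ, mul_ne_zero hα hγ, mul_ne_zero hβ hδ, ?_⟩
    rw [← Ideal.span_singleton_mul_span_singleton,
      ← Ideal.span_singleton_mul_span_singleton, Submonoid.coe_mul, Submonoid.coe_mul,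
      mul_mul_mul_comm, h, h', mul_mul_mul_comm]

/-- The ideal class monoid `C(R)` of an integral domain `R`: the nonzero ideals of `R` modulo
`≈`, with multiplication `[I] * [J] = [I * J]`. -/
def IdealClassMonoid (R : Type*) [CommRing R] [IsDomain R] : Type _ := (idealCon R).Quotient

instance (R : Type*) [CommRing R] [IsDomain R] : CommMonoid (IdealClassMonoid R) :=
  inferInstanceAs (CommMonoid (idealCon R).Quotient)

/-- The class `[I]` of a nonzero ideal `I`. -/
def idealClass {R : Type*} [CommRing R] [IsDomain R] (I : Ideal R) (hI : I ≠ ⊥) :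
    IdealClassMonoid R :=
  (idealCon R).mk' ⟨I, hI⟩

theorem idealClass_eq_iff {R : Type*} [CommRing R] [IsDomain R] {I J : Ideal R}
    {hI : I ≠ ⊥} {hJ : J ≠ ⊥} :
    idealClass I hI = idealClass J hJ ↔
      ∃ α β : R, α ≠ 0 ∧ β ≠ 0 ∧ Ideal.span {α} * I = Ideal.span {β} * J :=
  (idealCon R).eq

theorem idealClass_mul {R : Type*} [CommRing R] [IsDomain R] {I J : Ideal R}
    (hI : I ≠ ⊥) (hJ : J ≠ ⊥) (hIJ : I * J ≠ ⊥) :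
    idealClass I hI * idealClass J hJ = idealClass (I * J) hIJ :=
  rfl

theorem one_eq_idealClass {R : Type*} [CommRing R] [IsDomain R] (h : (1 : Ideal R) ≠ ⊥) :
    (1 : IdealClassMonoid R) = idealClass 1 h :=
  rfl

/-- An ideal `I` is invertible if `I * J` is a nonzero principal ideal for some ideal `J`. -/
def IsInvertibleIdeal {R : Type*} [CommRing R] (I : Ideal R) : Prop :=
  ∃ (J : Ideal R) (a : R), a ≠ 0 ∧ I * J = Ideal.span {a}

/-- The Picard group `Pic(R)`: the classes of invertible ideals, inside `C(R)`. -/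
def picard (R : Type*) [CommRing R] [IsDomain R] : Submonoid (IdealClassMonoid R) where
  carrier := {x | ∃ (I : Ideal R) (hI : I ≠ ⊥), IsInvertibleIdeal I ∧ x = idealClass I hI}
  mul_mem' := by
    rintro _ _ ⟨I, hI, ⟨I', a, ha, h⟩, rfl⟩ ⟨J, hJ, ⟨J', b, hb, h'⟩, rfl⟩
    refine ⟨I * J, (nonzeroIdeals R).mul_mem hI hJ,
      ⟨I' * J', a * b, mul_ne_zero ha hb, ?_⟩, rfl⟩
    rw [← Ideal.span_singleton_mul_span_singleton, mul_mul_mul_comm, h, h']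
  one_mem' := ⟨1, one_ne_zero (α := Ideal R), ⟨1, 1, one_ne_zero, by simp⟩, rfl⟩

theorem isUnit_picard {R : Type*} [CommRing R] [IsDomain R] (x : picard R) : IsUnit x := by
  obtain ⟨_, I, hI, ⟨J, a, ha, h⟩, rfl⟩ := x
  have ha' : Ideal.span {a} ≠ ⊥ := by simpa using ha
  have hJ : J ≠ ⊥ := by
    rintro rfl
    exact ha' (by rw [← h, Ideal.mul_bot])
  refine IsUnit.of_mul_eq_one
    ⟨idealClass J hJ, J, hJ, ⟨I, a, ha, by rw [mul_comm, h]⟩, rfl⟩ (Subtype.ext ?_)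
  change idealClass I hI * idealClass J hJ = 1
  rw [idealClass_mul hI hJ (h ▸ ha'), one_eq_idealClass (one_ne_zero (α := Ideal R)), idealClass_eq_iff]
  exact ⟨1, a, one_ne_zero, ha, by simp [h]⟩

noncomputable instance (R : Type*) [CommRing R] [IsDomain R] : CommGroup (picard R) :=
  commGroupOfIsUnit isUnit_picard

end General

section Cubic

/-- The polynomial `f_n(x) = x³ - n x² + (n - 1) x - 1`. -/
noncomputable def csPoly (n : ℤ) : ℤ[X] := X ^ 3 - C n * X ^ 2 + C (n - 1) * X - 1

/-- The ring `ℤ[Θ]`, as a subring of `ℂ`. -/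
abbrev ZAdjoin (Θ : ℂ) : Type := Algebra.adjoin ℤ ({Θ} : Set ℂ)

/-- The element `Θ` of `ℤ[Θ]`. -/
def gen (Θ : ℂ) : ZAdjoin Θ := ⟨Θ, Algebra.self_mem_adjoin_singleton ℤ Θ⟩

/-- The ideal `⟨Θ - c, d⟩` of `ℤ[Θ]`. -/
def pairIdeal (Θ : ℂ) (c d : ℤ) : Ideal (ZAdjoin Θ) :=
  Ideal.span {gen Θ - (c : ZAdjoin Θ), (d : ZAdjoin Θ)}

theorem pairIdeal_ne_bot (Θ : ℂ) (c d : ℤ) (hd : d ≠ 0) : pairIdeal Θ c d ≠ ⊥ := by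
  intro h
  have hm : (d : ZAdjoin Θ) ∈ pairIdeal Θ c d := Ideal.subset_span (by simp)
  rw [h, Ideal.mem_bot] at hm
  exact hd (by exact_mod_cast hm)

/-- The ideal class `[⟨Θ - c, d⟩] ∈ C(ℤ[Θ])`, for `d ≠ 0`. -/
def pairClass (Θ : ℂ) (c d : ℤ) (hd : d ≠ 0) : IdealClassMonoid (ZAdjoin Θ) :=
  idealClass (pairIdeal Θ c d) (pairIdeal_ne_bot Θ c d hd)

/-- The seven classes `I₀, I₁, …, I₆`. -/
def cls (Θ : ℂ) : Fin 7 → IdealClassMonoid (ZAdjoin Θ) :=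
  ![pairClass Θ 2 7 (by decide),
    pairClass Θ 7 17 (by decide),
    pairClass Θ 4 5 (by decide),
    pairClass Θ 11 13 (by decide),
    pairClass Θ 10 11 (by decide),
    pairClass Θ 14 19 (by decide),
    pairClass Θ 1 1 (by decide)]

/-- The multiplication table: the entry in row `i`, column `j` is the index of `Iᵢ * Iⱼ`. -/
def mulTable : Fin 7 → Fin 7 → Fin 7 :=
  ![![0, 0, 0, 0, 0, 0, 0],
    ![0, 2, 3, 4, 5, 6, 1],
    ![0, 3, 4, 5, 6, 1, 2],
    ![0, 4, 5, 6, 1, 2, 3],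
    ![0, 5, 6, 1, 2, 3, 4],
    ![0, 6, 1, 2, 3, 4, 5],
    ![0, 1, 2, 3, 4, 5, 6]]

end Cubic

end IdealClasses

/-! Let `O` be the maximal order of ℚ(Θ), y = Θ - 2 and w = y²/7. Then 1, y, w is an integral basis
of `O`, and R = ℤ[Θ] is the subring of index 7 on which two homomorphisms `φ`, `ψ` from `O` to `ZMod
7` agree: both kill y, while w goes to 0 and to 3. The elements killed by both form the conductor.

Since `O` is principal, an ideal J of R generates some αO. Then α⁻¹J lies between the conductor and
`O`, so it is determined by its image in F × F, F = `ZMod 7`. That image is a subspace contained in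
neither axis: a line ψ = tφ with t ≠ 0, or the whole plane, encoded as t = 0. The choice of α does
not matter, because every unit u of `O` satisfies φ u = ψ u. Slopes multiply, so the class monoid
embeds in the multiplicative monoid F (`exists_slopeHom`). The listed ideals have slopes 0 and 3,
3², …, 3⁶, which exhaust F.

Two arithmetic inputs remain. `isPrincipalIdealRing`: the discriminant is 7273 = 7 · 1039, the
Minkowski bound is below 19, 2 and 3 are inert, and the primes of degree one over 5, 7, 11, 13, 17
have explicit generators. `unit_eq`: the character φ/ψ on units has order dividing 6 and is trivial
on -1, Θ and Θ - 1. These generate a subgroup of index prime to 6, so no fundamental units have to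
be exhibited. -/

namespace IdealClasses

/-! ### Ideals of a ring glued at two residue maps, and their slopes. -/

section Glued

variable {R O F : Type*} [CommRing R] [CommRing O] [Field F]
  {ι : R →+* O} {φ ψ : O →+* F}

/-- `ι : R → O` identifies `R` with the subring of `O` on which the two jointly surjective
homomorphisms `φ, ψ : O → F` agree, and every unit of `O` lies in that subring. -/
structure IsGlued (ι : R →+* O) (φ ψ : O →+* F) : Prop where
  injective : Function.Injective ι
  surjective : ∀ a b : F, ∃ x, φ x = a ∧ ψ x = b
  mem_range : ∀ x, φ x = ψ x ↔ ∃ r, ι r = x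
  unit_eq : ∀ u : Oˣ, φ u = ψ u

/-- The elements `x` of `O` with `ψ x = t * φ x` (no condition for `t = 0`). -/
def slopeSet (φ ψ : O →+* F) (t : F) : Set O := {x | t = 0 ∨ ψ x = t * φ x}

/-- The image of the ideal `J` in `O` is `α` times the set of elements of slope `t`. -/
def HasSlope (ι : R →+* O) (φ ψ : O →+* F) (J : Ideal R) (α : O) (t : F) : Prop :=
  ι '' (J : Set R) = (α * ·) '' slopeSet φ ψ t

theorem mem_slopeSet_of_eq_zero (t : F) {x : O} (h : φ x = 0) (h' : ψ x = 0) :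
    x ∈ slopeSet φ ψ t := Or.inr (by simp [h, h'])

theorem add_mem_slopeSet {t : F} {x y : O} (hx : x ∈ slopeSet φ ψ t)
    (hy : y ∈ slopeSet φ ψ t) : x + y ∈ slopeSet φ ψ t := by
  rcases hx with h | hx
  · exact Or.inl h
  rcases hy with h | hy
  · exact Or.inl h
  · exact Or.inr (by rw [map_add, map_add, hx, hy, mul_add])

theorem mul_mem_slopeSet {t s : F} {x y : O} (hx : x ∈ slopeSet φ ψ t)
    (hy : y ∈ slopeSet φ ψ s) : x * y ∈ slopeSet φ ψ (t * s) := by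
  rcases hx with h | hx
  · exact Or.inl (by simp [h])
  rcases hy with h | hy
  · exact Or.inl (by simp [h])
  · exact Or.inr (by rw [map_mul, map_mul, hx, hy]; ring)

theorem HasSlope.span_mul {J : Ideal R} {α : O} {t : F} (hJ : HasSlope ι φ ψ J α t) (a : R) :
    HasSlope ι φ ψ (Ideal.span {a} * J) (ι a * α) t := by
  refine Set.Subset.antisymm ?_ ?_
  · rintro _ ⟨r, hr, rfl⟩
    obtain ⟨z, hz, rfl⟩ := Ideal.mem_span_singleton_mul.1 hr
    have h1 : ι z ∈ (α * ·) '' slopeSet φ ψ t := hJ ▸ ⟨z, hz, rfl⟩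
    obtain ⟨x, hx, ex⟩ := h1
    refine ⟨x, hx, ?_⟩
    simp only at ex ⊢
    rw [map_mul, ← ex]; ring
  · rintro _ ⟨x, hx, rfl⟩
    have h1 : α * x ∈ ι '' (J : Set R) := hJ ▸ ⟨x, hx, rfl⟩
    obtain ⟨z, hz, ez⟩ := h1
    exact ⟨a * z, Ideal.mul_mem_mul (Ideal.mem_span_singleton_self a) hz, by
      rw [map_mul, ez]; exact (mul_assoc _ _ _).symm⟩

namespace IsGlued

variable (h : IsGlued ι φ ψ)
include h

theorem map_eq (r : R) : φ (ι r) = ψ (ι r) := (h.mem_range _).2 ⟨r, rfl⟩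

theorem exists_apply_eq (a : F) : ∃ r : R, φ (ι r) = a ∧ ψ (ι r) = a := by
  obtain ⟨x, hx, hx'⟩ := h.surjective a a
  obtain ⟨r, rfl⟩ := (h.mem_range x).1 (hx.trans hx'.symm)
  exact ⟨r, hx, hx'⟩

theorem exists_of_eq_zero {x : O} (hx : φ x = 0) (hx' : ψ x = 0) : ∃ r, ι r = x :=
  (h.mem_range x).1 (hx.trans hx'.symm)

/-- The elements of slope `t` generate the unit ideal. -/
theorem exists_eq_one (t : F) : ∃ a j q : O, j ∈ slopeSet φ ψ t ∧ φ q = 0 ∧ ψ q = 0 ∧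
    a * j + q = 1 := by
  by_cases ht : t = 0
  · exact ⟨1, 1, 0, Or.inl ht, by simp⟩
  obtain ⟨j, hj, hj'⟩ := h.surjective 1 t
  obtain ⟨a, ha, ha'⟩ := h.surjective 1 t⁻¹
  exact ⟨a, j, 1 - a * j, Or.inr (by simp [hj, hj']), by simp [ha, hj], by simp [ha', hj', ht],
    by ring⟩

/-- From a j + q = 1, α is a combination of αj and αq, both of which lie in α'O. -/
theorem dvd_of_image_subset [IsDomain O] {α α' : O} {t t' : F}
    (heq : (α * ·) '' slopeSet φ ψ t = (α' * ·) '' slopeSet φ ψ t') : α' ∣ α := by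
  obtain ⟨a, j, q, hj, hq, hq', e⟩ := h.exists_eq_one t
  have h1 : α * j ∈ (α' * ·) '' slopeSet φ ψ t' := heq ▸ ⟨j, hj, rfl⟩
  have h2 : α * q ∈ (α' * ·) '' slopeSet φ ψ t' :=
    heq ▸ ⟨q, mem_slopeSet_of_eq_zero t hq hq', rfl⟩
  obtain ⟨b, -, hb⟩ := h1
  obtain ⟨c, -, hc⟩ := h2
  refine ⟨a * b + c, ?_⟩
  simp only at hb hc
  linear_combination (-α) * e - a * hb - hc

/-- An element with residues (1, t) detects the slope, unless t' = 0, where the slope set is all of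
`O`. -/
theorem slope_unique_aux {t t' : F} (hss : slopeSet φ ψ t ⊆ slopeSet φ ψ t') (ht' : t' ≠ 0) :
    t = t' := by
  obtain ⟨x, hx, hx'⟩ := h.surjective 1 t
  have := hss (Or.inr (by simp [hx, hx']) : x ∈ slopeSet φ ψ t)
  rcases this with h0 | h1
  · exact absurd h0 ht'
  · rw [hx, hx', mul_one] at h1
    exact h1

/-- α and α' differ by a unit u, and φ u = ψ u makes multiplication by u preserve every slope set.
-/
theorem slope_unique [IsDomain O] {α α' : O} (hα : α ≠ 0) {t t' : F}
    (heq : (α * ·) '' slopeSet φ ψ t = (α' * ·) '' slopeSet φ ψ t') : t = t' := by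
  obtain ⟨u, hu⟩ := associated_of_dvd_dvd (h.dvd_of_image_subset heq.symm)
    (h.dvd_of_image_subset heq)
  have huv : φ (u : O) = ψ (u : O) := h.unit_eq u
  have hu0 : φ (u : O) ≠ 0 := (u.isUnit.map φ).ne_zero
  have key : ∀ x, x ∈ slopeSet φ ψ t ↔ x ∈ (fun y : O => (u : O) * y) '' slopeSet φ ψ t' := by
    intro x
    constructor
    · intro hx
      have : α * x ∈ (α' * ·) '' slopeSet φ ψ t' := heq ▸ ⟨x, hx, rfl⟩
      obtain ⟨y, hy, e⟩ := this
      refine ⟨y, hy, mul_left_cancel₀ hα ?_⟩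
      simp only at e ⊢
      rw [← e, ← hu, mul_assoc]
    · rintro ⟨y, hy, rfl⟩
      have : α' * y ∈ (α * ·) '' slopeSet φ ψ t := heq ▸ ⟨y, hy, rfl⟩
      obtain ⟨x, hx, e⟩ := this
      simp only at e ⊢
      rw [← hu, mul_assoc] at e
      rwa [← mul_left_cancel₀ hα e]
  have key' : slopeSet φ ψ t = slopeSet φ ψ t' := by
    ext x
    rw [key]
    constructor
    · rintro ⟨y, hy | hy, rfl⟩
      · exact Or.inl hy
      · exact Or.inr (by simp only [map_mul]; rw [hy, huv]; ring)
    · intro hx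
      refine ⟨(↑u⁻¹ : O) * x, ?_, by simp⟩
      rcases hx with hx | hx
      · exact Or.inl hx
      · refine Or.inr ?_
        have := h.unit_eq u⁻¹
        rw [map_mul, map_mul, hx, this]; ring
  by_cases ht' : t' = 0
  · by_cases ht : t = 0
    · rw [ht, ht']
    · exact (h.slope_unique_aux key'.ge ht).symm
  · exact h.slope_unique_aux key'.le ht'

/-- If `J` generates the ideal `α O`, then `J` has a slope with respect to `α`. -/
theorem exists_hasSlope [IsDomain O] {J : Ideal R} {α : O} (hα : α ≠ 0)
    (hJ : J.map ι = Ideal.span {α}) : ∃ t, HasSlope ι φ ψ J α t := by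
  -- The conductor is an ideal of `O` lying in R, so it carries JO into J.
  have hP : ∀ x ∈ J.map ι, ∀ p, φ p = 0 → ψ p = 0 → ∃ r ∈ J, ι r = p * x := by
    intro x hx
    refine Submodule.span_induction (p := fun x _ => ∀ p, φ p = 0 → ψ p = 0 → ∃ r ∈ J, ι r = p * x)
      ?_ ?_ ?_ ?_ hx
    · rintro _ ⟨r, hr, rfl⟩ p hp hp'
      obtain ⟨s, rfl⟩ := h.exists_of_eq_zero hp hp'
      exact ⟨s * r, J.mul_mem_left s hr, by simp⟩
    · intro p _ _
      exact ⟨0, J.zero_mem, by simp⟩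
    · intro x y _ _ hx hy p hp hp'
      obtain ⟨r, hr, er⟩ := hx p hp hp'
      obtain ⟨s, hs, es⟩ := hy p hp hp'
      exact ⟨r + s, J.add_mem hr hs, by rw [map_add, er, es]; ring⟩
    · intro a x _ hx p hp hp'
      obtain ⟨r, hr, er⟩ := hx (p * a) (by simp [hp]) (by simp [hp'])
      exact ⟨r, hr, by rw [er, smul_eq_mul]; ring⟩
  have hαJ : α ∈ J.map ι := hJ ▸ Ideal.mem_span_singleton_self α
  have hdvd : ∀ r ∈ J, ∃ β, ι r = α * β := fun r hr =>
    Ideal.mem_span_singleton.1 (hJ ▸ Ideal.mem_map_of_mem ι hr)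
  -- The image of α⁻¹J lies in neither axis: otherwise JO ⊆ α ker χ, which puts 1 in ker χ.
  have hker : ∀ χ : O →+* F, ∃ r ∈ J, ∃ β, ι r = α * β ∧ χ β ≠ 0 := by
    intro χ
    by_contra! hcon
    have hle : J.map ι ≤ Ideal.span {α} * RingHom.ker χ := by
      rw [Ideal.map_le_iff_le_comap]
      intro r hr
      obtain ⟨β, hβ⟩ := hdvd r hr
      exact Ideal.mem_span_singleton_mul.2 ⟨β, hcon r hr β hβ, hβ.symm⟩
    obtain ⟨z, hz, e⟩ := Ideal.mem_span_singleton_mul.1 (hle hαJ)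
    have : z = 1 := mul_left_cancel₀ hα (by rw [e, mul_one])
    rw [this, RingHom.mem_ker, map_one] at hz
    exact one_ne_zero hz
  -- By `hP`, membership of β in α⁻¹J depends only on the residues (φ β, ψ β).
  have hfull : ∀ β, (∃ r ∈ J, ∃ γ, ι r = α * γ ∧ φ β = φ γ ∧ ψ β = ψ γ) →
      ∃ r ∈ J, ι r = α * β := by
    rintro β ⟨r, hr, γ, hγ, e, e'⟩
    obtain ⟨s, hs, es⟩ := hP α hαJ (β - γ) (by simp [e]) (by simp [e'])
    exact ⟨r + s, J.add_mem hr hs, by rw [map_add, hγ, es]; ring⟩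
  obtain ⟨r₀, hr₀, β₀, e₀, h₀⟩ := hker φ
  by_cases hline : ∀ r ∈ J, ∀ β, ι r = α * β → ψ β = ψ β₀ / φ β₀ * φ β
  · refine ⟨ψ β₀ / φ β₀, Set.Subset.antisymm ?_ ?_⟩
    · rintro _ ⟨r, hr, rfl⟩
      obtain ⟨β, hβ⟩ := hdvd r hr
      exact ⟨β, Or.inr (hline r hr β hβ), hβ.symm⟩
    · rintro _ ⟨β, hβ, rfl⟩
      have ht : ψ β₀ / φ β₀ ≠ 0 := by
        intro h0
        obtain ⟨r, hr, γ, hγ, hne⟩ := hker ψ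
        exact hne (by rw [hline r hr γ hγ, h0, zero_mul])
      have hβ' : ψ β = ψ β₀ / φ β₀ * φ β := hβ.resolve_left ht
      obtain ⟨s, hs, hs'⟩ := h.exists_apply_eq (φ β / φ β₀)
      obtain ⟨r, hr, e⟩ := hfull β ⟨s * r₀, J.mul_mem_left s hr₀, ι s * β₀, by
        rw [map_mul, e₀]; ring, by rw [map_mul, hs]; field_simp, by
        rw [map_mul, hs', hβ']; field_simp⟩
      exact ⟨r, hr, e⟩
  · push Not at hline
    obtain ⟨r₁, hr₁, β₁, e₁, h₁⟩ := hline
    refine ⟨0, Set.Subset.antisymm ?_ ?_⟩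
    · rintro _ ⟨r, hr, rfl⟩
      obtain ⟨β, hβ⟩ := hdvd r hr
      exact ⟨β, Or.inl rfl, hβ.symm⟩
    · rintro _ ⟨β, -, rfl⟩
      -- Two independent vectors span the plane: `D` is their determinant, and the scalars below
      -- come from Cramer's rule, realised by elements of R.
      have hD : ψ β₁ * φ β₀ - ψ β₀ * φ β₁ ≠ 0 := by
        intro h0
        apply h₁
        field_simp
        linear_combination h0
      set D := ψ β₁ * φ β₀ - ψ β₀ * φ β₁ with hDdef
      obtain ⟨s, hs, hs'⟩ := h.exists_apply_eq ((φ β * ψ β₁ - ψ β * φ β₁) / D)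
      obtain ⟨s₁, hs₁, hs₁'⟩ := h.exists_apply_eq ((ψ β * φ β₀ - φ β * ψ β₀) / D)
      obtain ⟨r, hr, e⟩ := hfull β ⟨s * r₀ + s₁ * r₁,
        J.add_mem (J.mul_mem_left s hr₀) (J.mul_mem_left s₁ hr₁), ι s * β₀ + ι s₁ * β₁, by
          rw [map_add, map_mul, map_mul, e₀, e₁]; ring, by
          rw [map_add, map_mul, map_mul, hs, hs₁]; field_simp; rw [hDdef]; ring, by
          rw [map_add, map_mul, map_mul, hs', hs₁']; field_simp; rw [hDdef]; ring⟩
      exact ⟨r, hr, e⟩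

/-- Supplies the denominator that moves multipliers from `O` into R in `idealClass_eq_iff_slope`. -/
theorem exists_conductor_ne_zero [IsDomain O] (hO : ¬ Function.Injective φ) :
    ∃ c : O, c ≠ 0 ∧ φ c = 0 ∧ ψ c = 0 := by
  have h1 : ∃ a : O, a ≠ 0 ∧ φ a = 0 := by
    by_contra! hcon
    exact hO ((injective_iff_map_eq_zero φ).2 fun a ha => by
      by_contra hne
      exact hcon a hne ha)
  obtain ⟨a, ha, ha'⟩ := h1
  obtain ⟨b, hb, hb'⟩ := h.surjective 1 0
  refine ⟨a * b, mul_ne_zero ha ?_, by simp [ha'], by simp [hb']⟩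
  rintro rfl
  simp at hb

/-- Lines of slopes t and s multiply to the line of slope ts, and the plane absorbs everything, in
agreement with 0 · s = 0. For the reverse inclusion, conductor elements are obtained from a j + q =
1, after which only residues matter. -/
theorem mul_hasSlope {I J : Ideal R} {α β : O} {t s : F} (hI : HasSlope ι φ ψ I α t)
    (hJ : HasSlope ι φ ψ J β s) : HasSlope ι φ ψ (I * J) (α * β) (t * s) := by
  refine Set.Subset.antisymm ?_ ?_
  · rintro _ ⟨r, hr, rfl⟩
    refine Submodule.mul_induction_on hr ?_ ?_
    · intro m hm n hn
      have h1 : ι m ∈ (α * ·) '' slopeSet φ ψ t := hI ▸ ⟨m, hm, rfl⟩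
      have h2 : ι n ∈ (β * ·) '' slopeSet φ ψ s := hJ ▸ ⟨n, hn, rfl⟩
      obtain ⟨x, hx, ex⟩ := h1
      obtain ⟨y, hy, ey⟩ := h2
      refine ⟨x * y, mul_mem_slopeSet hx hy, ?_⟩
      simp only at ex ey ⊢
      rw [map_mul, ← ex, ← ey]; ring
    · rintro x y ⟨a, ha, ea⟩ ⟨b, hb, eb⟩
      refine ⟨a + b, add_mem_slopeSet ha hb, ?_⟩
      simp only at ea eb ⊢
      rw [map_add, ← ea, ← eb]; ring
  · have hprod : ∀ x ∈ slopeSet φ ψ t, ∀ y ∈ slopeSet φ ψ s,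
        ∃ r ∈ I * J, ι r = α * β * (x * y) := by
      intro x hx y hy
      have h1 : α * x ∈ ι '' (I : Set R) := hI ▸ ⟨x, hx, rfl⟩
      have h2 : β * y ∈ ι '' (J : Set R) := hJ ▸ ⟨y, hy, rfl⟩
      obtain ⟨m, hm, em⟩ := h1
      obtain ⟨n, hn, en⟩ := h2
      exact ⟨m * n, Ideal.mul_mem_mul hm hn, by rw [map_mul, em, en]; ring⟩
    have hadd : ∀ x y z : O, (∃ r ∈ I * J, ι r = α * β * x) → (∃ r ∈ I * J, ι r = α * β * y) →
        z = x + y → ∃ r ∈ I * J, ι r = α * β * z := by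
      rintro x y _ ⟨r, hr, er⟩ ⟨r', hr', er'⟩ rfl
      exact ⟨r + r', (I * J).add_mem hr hr', by rw [map_add, er, er']; ring⟩
    have hP : ∀ x, φ x = 0 → ψ x = 0 → ∃ r ∈ I * J, ι r = α * β * x := by
      intro x hx hx'
      obtain ⟨a, j, q, hj, hq, hq', e⟩ := h.exists_eq_one (φ := φ) (ψ := ψ) s
      refine hadd (x * a * j) (x * q) x (hprod _ ?_ _ hj) (hprod _ ?_ _ ?_) ?_
      · exact mem_slopeSet_of_eq_zero t (by simp [hx]) (by simp [hx'])
      · exact mem_slopeSet_of_eq_zero t hx hx'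
      · exact mem_slopeSet_of_eq_zero s hq hq'
      · linear_combination (-x) * e
    rintro _ ⟨x, hx, rfl⟩
    change ∃ r ∈ I * J, ι r = α * β * x
    by_cases ht : t = 0
    · obtain ⟨a, j, q, hj, hq, hq', e⟩ := h.exists_eq_one (φ := φ) (ψ := ψ) s
      refine hadd (x * a * j) (x * q) x (hprod _ (Or.inl ht) _ hj) (hP _ ?_ ?_) ?_
      · simp [hq]
      · simp [hq']
      · linear_combination (-x) * e
    by_cases hs : s = 0
    · obtain ⟨a, j, q, hj, hq, hq', e⟩ := h.exists_eq_one (φ := φ) (ψ := ψ) t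
      refine hadd (j * (x * a)) (x * q) x (hprod _ hj _ (Or.inl hs)) (hP _ ?_ ?_) ?_
      · simp [hq]
      · simp [hq']
      · linear_combination (-x) * e
    have hx' := hx.resolve_left (mul_ne_zero ht hs)
    -- The product yz has residues (1, t)(φ x, s φ x), those of x, so x - yz is in the conductor.
    obtain ⟨y, hy, hy'⟩ := h.surjective 1 t
    obtain ⟨z, hz, hz'⟩ := h.surjective (φ x) (s * φ x)
    refine hadd (y * z) (x - y * z) x (hprod y (Or.inr ?_) z (Or.inr ?_)) (hP _ ?_ ?_) (by ring)
    · rw [hy, hy', mul_one]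
    · rw [hz, hz']
    · simp [hy, hz]
    · rw [map_sub, map_mul, hy', hz', hx']; ring

theorem idealClass_eq_iff_slope [IsDomain R] [IsDomain O] (hO : ¬ Function.Injective φ) {I J : Ideal R} {hI : I ≠ ⊥}
    {hJ : J ≠ ⊥} {α β : O} (hα : α ≠ 0) (hβ : β ≠ 0) {t s : F} (hIt : HasSlope ι φ ψ I α t)
    (hJs : HasSlope ι φ ψ J β s) : idealClass I hI = idealClass J hJ ↔ t = s := by
  rw [idealClass_eq_iff]
  constructor
  · rintro ⟨a, b, ha, hb, e⟩
    have h1 := hIt.span_mul a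
    have h2 := hJs.span_mul b
    rw [e] at h1
    exact h.slope_unique (mul_ne_zero ((map_ne_zero_iff ι h.injective).2 ha) hα)
      (Eq.trans (Eq.symm h1) h2)
  · rintro rfl
    -- For c in the conductor, cβ and cα come from R, and both cβ·I and cα·J have image cαβ times
    -- the slope set.
    obtain ⟨c, hc, hc1, hc2⟩ := h.exists_conductor_ne_zero hO
    obtain ⟨a, ha⟩ := h.exists_of_eq_zero (x := c * β) (by simp [hc1]) (by simp [hc2])
    obtain ⟨b, hb⟩ := h.exists_of_eq_zero (x := c * α) (by simp [hc1]) (by simp [hc2])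
    refine ⟨a, b, ?_, ?_, ?_⟩
    · rintro rfl
      exact mul_ne_zero hc hβ (by rw [← ha, map_zero])
    · rintro rfl
      exact mul_ne_zero hc hα (by rw [← hb, map_zero])
    · have h1 := hIt.span_mul a
      have h2 := hJs.span_mul b
      rw [ha] at h1
      rw [hb, mul_right_comm] at h2
      exact SetLike.coe_injective (h.injective.image_injective (Eq.trans h1 (Eq.symm h2)))

theorem exists_slope [IsDomain R] [IsDomain O] [IsPrincipalIdealRing O] {J : Ideal R} (hJ : J ≠ ⊥) :
    ∃ α, α ≠ 0 ∧ ∃ t, HasSlope ι φ ψ J α t := by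
  obtain ⟨α, hα⟩ := IsPrincipalIdealRing.principal (J.map ι)
  rw [Ideal.submodule_span_eq] at hα
  have hα0 : α ≠ 0 := by
    rintro rfl
    rw [Ideal.span_singleton_zero, Ideal.map_eq_bot_iff_of_injective h.injective] at hα
    exact hJ hα
  exact ⟨α, hα0, h.exists_hasSlope hα0 hα⟩

/-- The slope is an injective homomorphism from the ideal class monoid of `R` to `F`. -/
theorem exists_slopeHom [IsDomain R] [IsDomain O] [IsPrincipalIdealRing O] (hO : ¬ Function.Injective φ) :
    ∃ g : IdealClassMonoid R →* F, Function.Injective g ∧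
      ∀ (J : Ideal R) (hJ : J ≠ ⊥) (α : O) (t : F), α ≠ 0 → HasSlope ι φ ψ J α t →
        g (idealClass J hJ) = t := by
  have hex : ∀ x : IdealClassMonoid R, ∃ t : F, ∃ (J : Ideal R) (hJ : J ≠ ⊥) (α : O), α ≠ 0 ∧
      HasSlope ι φ ψ J α t ∧ x = idealClass J hJ := by
    intro x
    obtain ⟨⟨J, hJ⟩, rfl⟩ := (idealCon R).mk'_surjective x
    obtain ⟨α, hα, t, ht⟩ := h.exists_slope (φ := φ) (ψ := ψ) hJ
    exact ⟨t, J, hJ, α, hα, ht, rfl⟩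
  choose g hg using hex
  have hval : ∀ (J : Ideal R) (hJ : J ≠ ⊥) (α : O) (t : F), α ≠ 0 → HasSlope ι φ ψ J α t →
      g (idealClass J hJ) = t := by
    intro J hJ α t hα ht
    obtain ⟨J', hJ', α', hα', ht', e⟩ := hg (idealClass J hJ)
    exact ((h.idealClass_eq_iff_slope hO hα hα' ht ht').1 e).symm
  have hone : HasSlope ι φ ψ (1 : Ideal R) 1 1 := by
    ext x
    constructor
    · rintro ⟨r, -, rfl⟩
      exact ⟨ι r, Or.inr (by rw [one_mul, h.map_eq]), by simp⟩
    · rintro ⟨y, hy, rfl⟩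
      obtain ⟨r, hr⟩ := (h.mem_range y).1 (by
        rw [hy.resolve_left one_ne_zero, one_mul])
      exact ⟨r, by simp, by simp [hr]⟩
  refine ⟨⟨⟨g, ?_⟩, ?_⟩, ?_, hval⟩
  · rw [one_eq_idealClass one_ne_zero]
    exact hval _ _ 1 1 one_ne_zero hone
  · intro x y
    obtain ⟨I, hI, α, hα, ht, e⟩ := hg x
    obtain ⟨J, hJ, β, hβ, hs, e'⟩ := hg y
    have : x * y = idealClass (I * J) ((nonzeroIdeals R).mul_mem hI hJ) := by
      rw [e, e']; rfl
    change g (x * y) = g x * g y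
    rw [this]
    exact hval _ _ (α * β) _ (mul_ne_zero hα hβ) (h.mul_hasSlope ht hs)
  · intro x y hxy
    obtain ⟨I, hI, α, hα, ht, e⟩ := hg x
    obtain ⟨J, hJ, β, hβ, hs, e'⟩ := hg y
    rw [e, e', h.idealClass_eq_iff_slope hO hα hβ ht hs]
    exact hxy

/-- The slope of an ideal that contains an element prime to the conductor. -/
theorem slope_eq_div [IsDomain O] {J : Ideal R} {α : O} {t : F} (ht : HasSlope ι φ ψ J α t) {r : R}
    (hr : r ∈ J) (hφ : φ (ι r) ≠ 0) (hψα : ψ α ≠ 0) : t = φ α / ψ α := by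
  have h1 : ι r ∈ (α * ·) '' slopeSet φ ψ t := ht ▸ ⟨r, hr, rfl⟩
  obtain ⟨β, hβ, e⟩ := h1
  simp only at e
  have hr' := h.map_eq r
  rw [← e, map_mul] at hφ
  rw [← e, map_mul, map_mul] at hr'
  -- If t = 0, then α times an element with residues (1, 0) comes from R, forcing φ α = 0.
  have ht0 : t ≠ 0 := by
    intro h0
    obtain ⟨x, hx, hx'⟩ := h.surjective 1 0
    have : α * x ∈ ι '' (J : Set R) := ht ▸ ⟨x, Or.inl h0, rfl⟩
    obtain ⟨s, -, hs⟩ := this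
    have := h.map_eq s
    rw [hs, map_mul, map_mul, hx, hx', mul_one, mul_zero] at this
    rw [this, zero_mul] at hφ
    exact hφ rfl
  have hβ' := hβ.resolve_left ht0
  rw [hβ'] at hr'
  have hφβ : φ β ≠ 0 := right_ne_zero_of_mul hφ
  rw [eq_div_iff hψα]
  exact mul_right_cancel₀ hφβ (by linear_combination -hr')

/-- An ideal whose image in `O` is stable under multiplication by `O` has slope zero. -/
theorem slope_eq_zero [IsDomain O] {J : Ideal R} {α : O} (hα : α ≠ 0) {t : F} (ht : HasSlope ι φ ψ J α t)
    (hJ : ∀ r ∈ J, ∀ x : O, ∃ s ∈ J, ι s = ι r * x) : t = 0 := by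
  by_contra ht0
  -- Multiplication by residues (0, 1) moves (1, t) to (0, t), off the line of slope t ≠ 0.
  obtain ⟨b, hb, hb'⟩ := h.surjective 1 t
  obtain ⟨w, hw, hw'⟩ := h.surjective 0 1
  have h1 : α * b ∈ ι '' (J : Set R) := ht ▸ ⟨b, Or.inr (by rw [hb, hb', mul_one]), rfl⟩
  obtain ⟨r, hr, e⟩ := h1
  obtain ⟨s, hs, es⟩ := hJ r hr w
  have h2 : ι s ∈ (α * ·) '' slopeSet φ ψ t := ht ▸ ⟨s, hs, rfl⟩
  obtain ⟨x, hx, ex⟩ := h2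
  have hxx : x = b * w := mul_left_cancel₀ hα (by simp only at ex; rw [ex, es, e, mul_assoc])
  have := hx.resolve_left ht0
  rw [hxx, map_mul, map_mul, hb', hw, hw', mul_zero, mul_zero, mul_one] at this
  exact ht0 this

end IsGlued

end Glued

/-! ### Integral basis, discriminant and signature of the cubic field. -/

section IntegralBasis

open NumberField Module

/-- A family of `[K : ℚ]` integers with squarefree discriminant is an integral basis. -/
theorem exists_basis_of_squarefree_discr (K : Type*) [Field K] [NumberField K] {κ : Type*}
    [Fintype κ] [DecidableEq κ] (v : κ → 𝓞 K) (hcard : Fintype.card κ = finrank ℚ K)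
    (hv : Squarefree (Algebra.discr ℤ v)) : ∃ b : Basis κ ℤ (𝓞 K), ⇑b = v := by
  have hc : Fintype.card (Free.ChooseBasisIndex ℤ (𝓞 K)) = Fintype.card κ := by
    rw [hcard, ← RingOfIntegers.rank K, finrank_eq_card_chooseBasisIndex]
  let e := (RingOfIntegers.basis K).reindex (Fintype.equivOfCardEq hc)
  -- The discriminant of `v` is det² times that of `e`, so squarefreeness makes det a unit.
  have h1 := Algebra.discr_of_matrix_vecMul e (e.toMatrix v)
  rw [Basis.toMatrix_map_vecMul] at h1
  have h2 : IsUnit (e.toMatrix v).det := hv _ ⟨Algebra.discr ℤ e, by rw [h1]; ring⟩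
  rw [← Basis.det_apply, ← Module.Basis.is_basis_iff_det] at h2
  exact ⟨Basis.mk h2.1 h2.2.ge, Basis.coe_mk _ _⟩

/-- The integers `y, w` of the cubic field `K` satisfy the multiplication rules of
`y = Θ - 2`, `w = y² / 7`. -/
structure IsCubicPair (K : Type*) [Field K] [NumberField K] (y w : 𝓞 K) : Prop where
  finrank_eq : finrank ℚ K = 3
  y_mul_y : y * y = 7 * w
  y_mul_w : y * w = 7 + 10 * y + 21 * w
  w_mul_w : w * w = 21 + 31 * y + 73 * w
  eq_zero : ∀ a b c : ℚ, (a : K) + b * y + c * w = 0 → a = 0 ∧ b = 0 ∧ c = 0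

namespace IsCubicPair

variable {K : Type*} [Field K] [NumberField K] {y w : 𝓞 K} (h : IsCubicPair K y w)
include h

theorem exists_rat_basis : ∃ B : Basis (Fin 3) ℚ K, ⇑B = ![1, (y : K), (w : K)] := by
  have hli : LinearIndependent ℚ ![1, (y : K), (w : K)] := by
    rw [Fintype.linearIndependent_iff]
    intro g hg
    simp only [Fin.sum_univ_three, Matrix.cons_val_zero, Matrix.cons_val_one,
      Matrix.cons_val, Algebra.smul_def, mul_one, eq_ratCast] at hg
    obtain ⟨h0, h1, h2⟩ := h.eq_zero _ _ _ hg
    intro i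
    fin_cases i <;> assumption
  exact ⟨basisOfLinearIndependentOfCardEqFinrank hli (by simp [h.finrank_eq]), by simp⟩

/-- In the basis 1, y, w the matrix of multiplication has diagonal a, a + 10c, a + 21b + 73c. -/
theorem trace_eq (a b c : ℤ) :
    Algebra.trace ℤ (𝓞 K) (a + b * y + c * w) = 3 * a + 21 * b + 83 * c := by
  obtain ⟨B, hB⟩ := h.exists_rat_basis
  have hrepr : ∀ (x : K) (a b c : ℚ) (i : Fin 3), x = a + b * y + c * w →
      B.repr x i = ![a, b, c] i := by
    intro x a b c i hx
    have : x = ∑ j, ![a, b, c] j • B j := by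
      rw [hx, hB]
      simp [Fin.sum_univ_three, Algebra.smul_def]
    rw [this, B.repr_sum_self]
  have hyy : (y * y : K) = 7 * w := by
    simpa only [map_mul, map_add, map_ofNat] using congrArg (algebraMap (𝓞 K) K) h.y_mul_y
  have hyw : (y * w : K) = 7 + 10 * y + 21 * w := by
    simpa only [map_mul, map_add, map_ofNat] using congrArg (algebraMap (𝓞 K) K) h.y_mul_w
  have hww : (w * w : K) = 21 + 31 * y + 73 * w := by
    simpa only [map_mul, map_add, map_ofNat] using congrArg (algebraMap (𝓞 K) K) h.w_mul_w
  have hB0 : B 0 = 1 := by rw [hB]; rfl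
  have hB1 : B 1 = y := by rw [hB]; rfl
  have hB2 : B 2 = w := by rw [hB]; rfl
  have key : Algebra.trace ℚ K ((a + b * y + c * w : 𝓞 K) : K) = 3 * a + 21 * b + 83 * c := by
    rw [Algebra.trace_eq_matrix_trace B, Matrix.trace_fin_three]
    simp only [Algebra.leftMulMatrix_eq_repr_mul, hB0, hB1, hB2]
    rw [hrepr _ a b c 0 (by simp),
      hrepr _ (7 * c) (a + 10 * c) (7 * b + 21 * c) 1 (by
        simp only [map_add, map_mul, map_intCast]
        push_cast
        linear_combination (b : K) * hyy + (c : K) * hyw),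
      hrepr _ (7 * b + 21 * c) (10 * b + 31 * c) (a + 21 * b + 73 * c) 2 (by
        simp only [map_add, map_mul, map_intCast]
        push_cast
        linear_combination (b : K) * hyw + (c : K) * hww)]
    simp only [Matrix.cons_val_zero, Matrix.cons_val_one, Matrix.cons_val]
    ring
  rw [← Algebra.coe_trace_int] at key
  exact_mod_cast key

theorem discr_eq : Algebra.discr ℤ ![1, y, w] = 7273 := by
  have h11 := h.trace_eq 1 0 0
  have h1y := h.trace_eq 0 1 0
  have h1w := h.trace_eq 0 0 1
  have hyy := h.trace_eq 0 0 7
  have hyw := h.trace_eq 7 10 21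
  have hww := h.trace_eq 21 31 73
  push_cast at h11 h1y h1w hyy hyw hww
  simp only [zero_mul, one_mul, add_zero, zero_add] at h11 h1y h1w hyy
  rw [← h.y_mul_y] at hyy
  rw [← h.y_mul_w] at hyw
  rw [← h.w_mul_w] at hww
  have hwy := hyw
  rw [mul_comm y w] at hwy
  rw [Algebra.discr_def, Matrix.det_fin_three]
  simp only [Algebra.traceMatrix_apply, Algebra.traceForm_apply, Matrix.cons_val_zero,
    Matrix.cons_val_one, Matrix.cons_val, one_mul, mul_one]
  rw [h11, h1y, h1w, hyy, hyw, hwy, hww]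
  norm_num

theorem exists_basis : ∃ B : Basis (Fin 3) ℤ (𝓞 K), ⇑B = ![1, y, w] := by
  refine exists_basis_of_squarefree_discr K _ (by simp [h.finrank_eq]) ?_
  rw [h.discr_eq, ← Int.squarefree_natAbs]
  change Squarefree (7 * 1039)
  rw [Nat.squarefree_mul (by norm_num)]
  exact ⟨Irreducible.squarefree Nat.prime_seven, Irreducible.squarefree (by norm_num : Nat.Prime 1039)⟩

theorem numberField_discr_eq : discr K = 7273 := by
  obtain ⟨B, hB⟩ := h.exists_basis
  rw [← discr_eq_discr K B, hB, h.discr_eq]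

theorem exists_coord (x : 𝓞 K) : ∃ a b c : ℤ, x = a + b * y + c * w := by
  obtain ⟨B, hB⟩ := h.exists_basis
  refine ⟨B.repr x 0, B.repr x 1, B.repr x 2, ?_⟩
  conv_lhs => rw [← B.sum_repr x]
  simp [Fin.sum_univ_three, hB]

/-- The three relations are the full multiplication table of an integral basis, so any solution in
`S` gives a homomorphism. It produces the maps to `ZMod p` for p = 5, 7, 13. -/
theorem exists_ringHom {S : Type*} [CommRing S] (Y W : S) (hYY : Y * Y = 7 * W)
    (hYW : Y * W = 7 + 10 * Y + 21 * W) (hWW : W * W = 21 + 31 * Y + 73 * W) :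
    ∃ f : 𝓞 K →+* S, f y = Y ∧ f w = W := by
  obtain ⟨B, hB⟩ := h.exists_basis
  let g : 𝓞 K →ₗ[ℤ] S := B.constr ℤ ![1, Y, W]
  have hB0 : B 0 = 1 := by rw [hB]; rfl
  have hB1 : B 1 = y := by rw [hB]; rfl
  have hB2 : B 2 = w := by rw [hB]; rfl
  have h1 : g 1 = 1 := by rw [← hB0, B.constr_basis]; rfl
  have hy : g y = Y := by rw [← hB1, B.constr_basis]; rfl
  have hw : g w = W := by rw [← hB2, B.constr_basis]; rfl
  have hg : ∀ a b c : ℤ, g (a + b * y + c * w) = a + b * Y + c * W := by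
    intro a b c
    have : (a + b * y + c * w : 𝓞 K) = a • (1 : 𝓞 K) + b • y + c • w := by simp
    rw [this, map_add, map_add, map_smul, map_smul, map_smul, h1, hy, hw]
    simp
  refine ⟨⟨⟨⟨g, h1⟩, ?_⟩, map_zero g, map_add g⟩, hy, hw⟩
  intro x x'
  obtain ⟨a, b, c, rfl⟩ := h.exists_coord x
  obtain ⟨a', b', c', rfl⟩ := h.exists_coord x'
  have : (a + b * y + c * w) * (a' + b' * y + c' * w) =
      ((a * a' + 7 * (b * c' + c * b') + 21 * (c * c') : ℤ) : 𝓞 K) +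
      ((a * b' + b * a' + 10 * (b * c' + c * b') + 31 * (c * c') : ℤ) : 𝓞 K) * y +
      ((a * c' + c * a' + 7 * (b * b') + 21 * (b * c' + c * b') + 73 * (c * c') : ℤ) : 𝓞 K) *
        w := by
    push_cast
    linear_combination (b * b' : 𝓞 K) * h.y_mul_y + (b * c' + c * b' : 𝓞 K) * h.y_mul_w +
      (c * c' : 𝓞 K) * h.w_mul_w
  change g _ = g _ * g _
  rw [this, hg, hg, hg]
  push_cast
  linear_combination (-(b * b') : S) * hYY - (b * c' + c * b' : S) * hYW - (c * c' : S) * hWW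

theorem nrComplexPlaces_eq : InfinitePlace.nrComplexPlaces K = 0 := by
  have h1 := sign_discr K
  rw [h.numberField_discr_eq] at h1
  have h2 := InfinitePlace.card_add_two_mul_card_eq_rank K
  rw [h.finrank_eq] at h2
  -- A positive discriminant forces an even number of complex places; degree 3 allows only 0 or 1.
  have h3 : InfinitePlace.nrComplexPlaces K ≠ 1 := by
    intro h3
    rw [h3] at h1
    simp at h1
  omega

theorem units_rank_eq : Units.rank K = 2 := by
  have h2 := InfinitePlace.card_add_two_mul_card_eq_rank K
  have h3 := InfinitePlace.card_eq_nrRealPlaces_add_nrComplexPlaces K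
  rw [h.finrank_eq, h.nrComplexPlaces_eq] at h2
  rw [h.nrComplexPlaces_eq] at h3
  rw [Units.rank, h3]
  omega

end IsCubicPair

end IntegralBasis

/-! ### The maximal order is a principal ideal domain. -/

section PrincipalIdeals

open NumberField Module

/-- A prime ideal whose norm is a prime `p` is the kernel of a homomorphism to `ZMod p`. -/
theorem exists_ringHom_ker_eq {A : Type*} [CommRing A] [IsDedekindDomain A] [Free ℤ A]
    {p : ℕ} (hp : p.Prime) {P : Ideal A} (hP : Ideal.absNorm P = p) :
    ∃ f : A →+* ZMod p, RingHom.ker f = P := by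
  have hcard : Nat.card (A ⧸ P) = p := by
    rw [← hP, Ideal.absNorm_apply, Submodule.cardQuot_apply]
  have : Finite (A ⧸ P) := Nat.finite_of_card_ne_zero (hcard ▸ hp.ne_zero)
  let _ := Fintype.ofFinite (A ⧸ P)
  let e := ZMod.ringEquivOfPrime (A ⧸ P) hp (by rw [← Nat.card_eq_fintype_card, hcard])
  refine ⟨(e.symm : A ⧸ P →+* ZMod p).comp (Ideal.Quotient.mk P), ?_⟩
  ext x
  simp [RingHom.mem_ker, Ideal.Quotient.eq_zero_iff_mem]

/-- A certificate format: quotients `u`, `v` and Bézout coefficients `s`, `t`. -/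
theorem span_pair_eq_span_singleton {A : Type*} [CommRing A] {a b π u v s t : A}
    (ha : a = π * u) (hb : b = π * v) (hπ : π = s * a + t * b) :
    Ideal.span {a, b} = Ideal.span {π} := by
  apply le_antisymm
  · rw [Ideal.span_le, Set.insert_subset_iff, Set.singleton_subset_iff]
    exact ⟨Ideal.mem_span_singleton.2 ⟨u, ha⟩, Ideal.mem_span_singleton.2 ⟨v, hb⟩⟩
  · rw [Ideal.span_singleton_le_iff_mem, Ideal.mem_span_pair]
    exact ⟨s, t, hπ.symm⟩

namespace IsCubicPair

variable {K : Type*} [Field K] [NumberField K] {y w : 𝓞 K} (h : IsCubicPair K y w)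
include h

/-- Here y - 2 = Θ - 4. This and the next four lemmas extend the ideals of I₂, I₄, I₃, I₁, I₅ to
`O`; the generators also determine their slopes. -/
theorem span_eq_five : Ideal.span {y - 2, 5} = Ideal.span {-1 - y - w} :=
  span_pair_eq_span_singleton (u := 65 + 35 * y - 11 * w) (v := -103 - 54 * y + 17 * w)
    (s := -7 - 3 * y) (t := -3 + 4 * w)
    (by linear_combination 35 * h.y_mul_y + 24 * h.y_mul_w - 11 * h.w_mul_w)
    (by linear_combination (-54) * h.y_mul_y - 37 * h.y_mul_w + 17 * h.w_mul_w)
    (by linear_combination 3 * h.y_mul_y)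

theorem span_eq_eleven : Ideal.span {y - 8, 11} = Ideal.span {-1 + 2 * w} :=
  span_pair_eq_span_singleton (u := 134 + 111 * y - 34 * w) (v := -151 - 124 * y + 38 * w)
    (s := 128 + 16 * y) (t := 93 - 10 * w)
    (by linear_combination (-222) * h.y_mul_w + 68 * h.w_mul_w)
    (by linear_combination 248 * h.y_mul_w - 76 * h.w_mul_w)
    (by linear_combination (-16) * h.y_mul_y)

theorem span_eq_thirteen : Ideal.span {y - 9, 13} = Ideal.span {-2 - 2 * y - w} :=
  span_pair_eq_span_singleton (u := 295 + 142 * y - 45 * w) (v := -381 - 183 * y + 58 * w)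
    (s := -20 - 2 * y) (t := -14 + w)
    (by linear_combination 284 * h.y_mul_y + 52 * h.y_mul_w - 45 * h.w_mul_w)
    (by linear_combination (-366) * h.y_mul_y - 67 * h.y_mul_w + 58 * h.w_mul_w)
    (by linear_combination 2 * h.y_mul_y)

theorem span_eq_seventeen : Ideal.span {y - 5, 17} = Ideal.span {-1 - y + w} :=
  span_pair_eq_span_singleton (u := -58 - 25 * y + 8 * w) (v := 165 + 72 * y - 23 * w)
    (s := 24 + 5 * y) (t := 7 - 2 * w)
    (by linear_combination (-25) * h.y_mul_y + 33 * h.y_mul_w - 8 * h.w_mul_w)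
    (by linear_combination 72 * h.y_mul_y - 95 * h.y_mul_w + 23 * h.w_mul_w)
    (by linear_combination (-5) * h.y_mul_y)

theorem span_eq_nineteen : Ideal.span {y - 12, 19} = Ideal.span {-2 - 2 * y + w} :=
  span_pair_eq_span_singleton (u := -106 - 47 * y + 15 * w) (v := 155 + 69 * y - 22 * w)
    (s := 130 + 11 * y) (t := 82 - 4 * w)
    (by linear_combination (-94) * h.y_mul_y + 77 * h.y_mul_w - 15 * h.w_mul_w)
    (by linear_combination 138 * h.y_mul_y - 113 * h.y_mul_w + 22 * h.w_mul_w)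
    (by linear_combination (-11) * h.y_mul_y)

theorem map_relations {S : Type*} [CommRing S] (f : 𝓞 K →+* S) :
    f y * f y = 7 * f w ∧ f y * f w = 7 + 10 * f y + 21 * f w ∧
      f w * f w = 21 + 31 * f y + 73 * f w := by
  refine ⟨?_, ?_, ?_⟩
  · simpa only [map_mul, map_ofNat] using congrArg f h.y_mul_y
  · simpa only [map_mul, map_add, map_ofNat] using congrArg f h.y_mul_w
  · simpa only [map_mul, map_add, map_ofNat] using congrArg f h.w_mul_w

/-- If `7` is invertible modulo `p`, the kernel of a homomorphism to `ZMod p` is generated by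
`y - Y` and `p`. -/
theorem ker_eq_span {p : ℕ} (hp : IsCoprime (7 : ℤ) p) (f : 𝓞 K →+* ZMod p) {Y : ℤ}
    (hY : f y = Y) : RingHom.ker f = Ideal.span {y - (Y : 𝓞 K), (p : 𝓞 K)} := by
  apply le_antisymm
  · intro x hx
    obtain ⟨a, b, c, rfl⟩ := h.exists_coord x
    rw [RingHom.mem_ker] at hx
    -- Since 7w = y², 7x is a polynomial in y, and division by y - Y leaves an integer, divisible by
    -- p because x is in the kernel. Bézout for 7 and p then removes the factor 7.
    have h7 : (7 : 𝓞 K) * (a + b * y + c * w) = (7 * b + c * (y + Y)) * (y - Y) +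
        ((7 * a + 7 * b * Y + c * Y ^ 2 : ℤ) : 𝓞 K) := by
      push_cast
      linear_combination (-c : 𝓞 K) * h.y_mul_y
    have hn : (p : ℤ) ∣ 7 * a + 7 * b * Y + c * Y ^ 2 := by
      rw [← ZMod.intCast_zmod_eq_zero_iff_dvd]
      have := congrArg f h7
      rw [map_mul, hx, map_add, map_mul, map_sub, hY, map_intCast, map_intCast, sub_self] at this
      simpa using this.symm
    obtain ⟨m, hm⟩ := hn
    obtain ⟨r, s, hrs⟩ := hp
    have hrs' : (r : 𝓞 K) * 7 + s * p = 1 := by exact_mod_cast congrArg (Int.cast (R := 𝓞 K)) hrs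
    rw [hm] at h7
    rw [Ideal.mem_span_pair]
    refine ⟨r * (7 * b + c * (y + Y)), r * m + s * (a + b * y + c * w), ?_⟩
    push_cast at h7
    linear_combination (-(r : 𝓞 K)) * h7 + (a + b * y + c * w) * hrs'
  · rw [Ideal.span_le, Set.insert_subset_iff, Set.singleton_subset_iff]
    constructor
    · simp [RingHom.mem_ker, hY]
    · simp [RingHom.mem_ker]

/-- `ker_eq_span` does not apply at 7. Here (f y)² = 0 gives f y = 0, and f w is 0 or 3; each case
has an explicit generator. -/
theorem isPrincipal_ker_seven (f : 𝓞 K →+* ZMod 7) : (RingHom.ker f).IsPrincipal := by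
  obtain ⟨h1, h2, h3⟩ := h.map_relations f
  have key : ∀ Y W : ZMod 7, Y * Y = 7 * W → Y * W = 7 + 10 * Y + 21 * W →
      W * W = 21 + 31 * Y + 73 * W → Y = 0 ∧ (W = 0 ∨ W = 3) := by decide
  obtain ⟨hy, hw⟩ := key _ _ h1 h2 h3
  have main : ∀ (π u v t : 𝓞 K) (W : ℤ), f π = 0 → f w = W → y = π * u → w - W = π * v →
      7 = π * t → RingHom.ker f = Ideal.span {π} := by
    intro π u v t W hπ hW hu hv ht
    apply le_antisymm
    · intro x hx
      obtain ⟨a, b, c, rfl⟩ := h.exists_coord x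
      rw [RingHom.mem_ker] at hx
      have hn : ((7 : ℕ) : ℤ) ∣ a + c * W := by
        rw [← ZMod.intCast_zmod_eq_zero_iff_dvd]
        simpa [hy, hW] using hx
      obtain ⟨m, hm⟩ := hn
      have hm' : (a + c * W : 𝓞 K) = 7 * m := by exact_mod_cast congrArg (Int.cast (R := 𝓞 K)) hm
      exact Ideal.mem_span_singleton.2 ⟨b * u + c * v + m * t, by
        linear_combination hm' + (b : 𝓞 K) * hu + (c : 𝓞 K) * hv + (m : 𝓞 K) * ht⟩
    · rwa [Ideal.span_singleton_le_iff_mem, RingHom.mem_ker]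
  rcases hw with hw | hw
  · exact ⟨-w, main (-w) (10 + 3 * y - w) (-1) (-79 - 31 * y + 10 * w) 0 (by simp [hw])
      (by simp [hw]) (by linear_combination 3 * h.y_mul_w - h.w_mul_w) (by simp)
      (by linear_combination (-31) * h.y_mul_w + 10 * h.w_mul_w)⟩
  · exact ⟨-1 - y - 2 * w, main (-1 - y - 2 * w) (-7 - 10 * y + 3 * w) (3 - 7 * y + 2 * w)
      (24 * y - 7 * w) 3 (by
        rw [map_sub, map_sub, map_mul, map_neg, map_one, map_ofNat, hy, hw]; decide) (by simp [hw])
      (by linear_combination (-10) * h.y_mul_y - 17 * h.y_mul_w + 6 * h.w_mul_w)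
      (by push_cast; linear_combination (-7) * h.y_mul_y - 12 * h.y_mul_w + 4 * h.w_mul_w)
      (by linear_combination 24 * h.y_mul_y + 41 * h.y_mul_w - 14 * h.w_mul_w)⟩

/-- A prime `p` modulo which the multiplication rules define a field generates a maximal ideal. -/
theorem eq_span_of_inert {p : ℕ} {P : Ideal (𝓞 K)} (hP : P ≠ ⊤) (hpP : (p : 𝓞 K) ∈ P)
    (hinv : ∀ a b c : ZMod p, (a = 0 ∧ b = 0 ∧ c = 0) ∨ ∃ a' b' c' : ZMod p,
      a * a' + 7 * (b * c' + c * b') + 21 * (c * c') = 1 ∧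
      a * b' + b * a' + 10 * (b * c' + c * b') + 31 * (c * c') = 0 ∧
      a * c' + c * a' + 7 * (b * b') + 21 * (b * c' + c * b') + 73 * (c * c') = 0) :
    P = Ideal.span {(p : 𝓞 K)} := by
  apply le_antisymm
  · intro x hx
    obtain ⟨a, b, c, rfl⟩ := h.exists_coord x
    rcases hinv a b c with ⟨ha, hb, hc⟩ | ⟨a', b', c', e1, e2, e3⟩
    · rw [ZMod.intCast_zmod_eq_zero_iff_dvd] at ha hb hc
      obtain ⟨a, rfl⟩ := ha
      obtain ⟨b, rfl⟩ := hb
      obtain ⟨c, rfl⟩ := hc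
      exact Ideal.mem_span_singleton.2 ⟨a + b * y + c * w, by push_cast; ring⟩
    -- An inverse of x modulo p, lifted to `𝓞 K`, shows that 1 lies in P.
    · exfalso
      obtain ⟨a', rfl⟩ := ZMod.intCast_surjective a'
      obtain ⟨b', rfl⟩ := ZMod.intCast_surjective b'
      obtain ⟨c', rfl⟩ := ZMod.intCast_surjective c'
      rw [← sub_eq_zero] at e1
      have d1 : (p : ℤ) ∣ a * a' + 7 * (b * c' + c * b') + 21 * (c * c') - 1 := by
        rw [← ZMod.intCast_zmod_eq_zero_iff_dvd]; exact_mod_cast e1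
      have d2 : (p : ℤ) ∣ a * b' + b * a' + 10 * (b * c' + c * b') + 31 * (c * c') := by
        rw [← ZMod.intCast_zmod_eq_zero_iff_dvd]; exact_mod_cast e2
      have d3 : (p : ℤ) ∣
          a * c' + c * a' + 7 * (b * b') + 21 * (b * c' + c * b') + 73 * (c * c') := by
        rw [← ZMod.intCast_zmod_eq_zero_iff_dvd]; exact_mod_cast e3
      obtain ⟨k, hk⟩ := d1
      obtain ⟨l, hl⟩ := d2
      obtain ⟨m, hm⟩ := d3
      replace hk := congrArg (Int.cast (R := 𝓞 K)) hk
      replace hl := congrArg (Int.cast (R := 𝓞 K)) hl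
      replace hm := congrArg (Int.cast (R := 𝓞 K)) hm
      push_cast at hk hl hm
      refine hP ((Ideal.eq_top_iff_one P).2 ?_)
      have : (1 : 𝓞 K) = (a' + b' * y + c' * w) * (a + b * y + c * w) -
          (k + l * y + m * w) * p := by
        linear_combination -hk - y * hl - w * hm - (b * b' : 𝓞 K) * h.y_mul_y -
          (b * c' + c * b' : 𝓞 K) * h.y_mul_w - (c * c' : 𝓞 K) * h.w_mul_w
      rw [this]
      exact P.sub_mem (P.mul_mem_left _ hx) (P.mul_mem_left _ hpP)
  · rwa [Ideal.span_singleton_le_iff_mem]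

theorem isPrincipal_of_absNorm_eq {p : ℕ} (hp : p ∈ ({5, 7, 11, 13, 17} : Finset ℕ))
    {P : Ideal (𝓞 K)} (hP : Ideal.absNorm P = p) : P.IsPrincipal := by
  have main : ∀ (q : ℕ) (Y : ℤ) (π : 𝓞 K), q.Prime → IsCoprime (7 : ℤ) q →
      (∀ Y' W : ZMod q, Y' * Y' = 7 * W → Y' * W = 7 + 10 * Y' + 21 * W →
      W * W = 21 + 31 * Y' + 73 * W → Y' = Y) → Ideal.absNorm P = q →
      Ideal.span {y - (Y : 𝓞 K), (q : 𝓞 K)} = Ideal.span {π} → P.IsPrincipal := by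
    intro q Y π hq hq7 key hPq hspan
    obtain ⟨f, rfl⟩ := exists_ringHom_ker_eq hq hPq
    obtain ⟨h1, h2, h3⟩ := h.map_relations f
    exact ⟨π, (h.ker_eq_span hq7 f (key _ _ h1 h2 h3)).trans hspan⟩
  simp only [Finset.mem_insert, Finset.mem_singleton] at hp
  rcases hp with rfl | rfl | rfl | rfl | rfl
  · exact main 5 2 _ (by norm_num) (by norm_num) (by decide) hP
      (by push_cast; exact h.span_eq_five)
  · obtain ⟨f, rfl⟩ := exists_ringHom_ker_eq (by norm_num) hP
    exact h.isPrincipal_ker_seven f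
  · exact main 11 8 _ (by norm_num) (by norm_num) (by decide) hP
      (by push_cast; exact h.span_eq_eleven)
  · exact main 13 9 _ (by norm_num) (by norm_num) (by decide) hP
      (by push_cast; exact h.span_eq_thirteen)
  · exact main 17 5 _ (by norm_num) (by norm_num) (by decide) hP
      (by push_cast; exact h.span_eq_seventeen)

theorem isPrincipalIdealRing : IsPrincipalIdealRing (𝓞 K) := by
  apply RingOfIntegers.isPrincipalIdealRing_of_isPrincipal_of_pow_le_of_mem_primesOver_of_mem_Icc
  have hM : ⌊(4 / Real.pi) ^ InfinitePlace.nrComplexPlaces K *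
      (((finrank ℚ K).factorial : ℝ) / (finrank ℚ K : ℝ) ^ finrank ℚ K *
        √|(discr K : ℝ)|)⌋₊ ≤ 18 := by
    rw [h.nrComplexPlaces_eq, h.numberField_discr_eq, h.finrank_eq, pow_zero, one_mul]
    refine Nat.lt_succ_iff.1 ((Nat.floor_lt (by positivity)).2 ?_)
    -- The Minkowski factor is 3!/3³ = 2/9, and 85.5 · 2/9 = 19.
    have : √|((7273 : ℤ) : ℝ)| < 85.5 := by
      rw [Real.sqrt_lt' (by norm_num)]
      norm_num
    norm_num [Nat.factorial] at this ⊢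
    linarith
  rintro p hpM hp P ⟨hP, hover⟩ hle
  have hple : p ≤ 18 := (Finset.mem_Icc.1 hpM).2.trans hM
  have hpow := hle.trans hM
  have hpP : (p : 𝓞 K) ∈ P := by
    have : (p : ℤ) ∈ P.under ℤ := by
      rw [← hover.over]; exact Ideal.mem_span_singleton_self _
    simpa using this
  have hnorm : Ideal.absNorm P = p ^ P.inertiaDeg ℤ := by
    rw [← Ideal.natAbs_pow_inertiaDeg (p : ℤ) P]
    simp
  have hne : Ideal.absNorm P ≠ 1 := by
    rw [Ne, Ideal.absNorm_eq_one_iff]; exact hP.ne_top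
  -- Degree at least two would give norm at least 25, above the bound.
  have hdeg : 5 ≤ p → Ideal.absNorm P = p := by
    intro h5
    have : P.inertiaDeg ℤ < 2 := by
      by_contra! hcon
      have := Nat.pow_le_pow_right hp.pos hcon
      nlinarith
    interval_cases P.inertiaDeg ℤ
    · exact absurd (by simpa using hnorm) hne
    · simpa using hnorm
  -- The last alternative is for the inert primes 2 and 3.
  interval_cases p <;> first
    | (exfalso; revert hp; norm_num; done)
    | exact h.isPrincipal_of_absNorm_eq (by decide) (hdeg (by norm_num))
    | exact ⟨_, h.eq_span_of_inert hP.ne_top hpP (by decide)⟩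

end IsCubicPair

end PrincipalIdeals

/-! ### Subgroups of index prime to 6 in a group of rank two. -/

section Saturation

variable {G : Type*} [CommGroup G] {T : Subgroup G} {ε₁ ε₂ x z e e' : G} {a b c d : ℤ}

theorem exists_kernel_vector {F : Type*} [Field F] {a b c d : F} (h : a * d - b * c = 0) :
    ∃ m n : F, ¬ (m = 0 ∧ n = 0) ∧ m * a + n * c = 0 ∧ m * b + n * d = 0 := by
  by_cases h1 : d = 0 ∧ b = 0
  · obtain ⟨rfl, rfl⟩ := h1
    by_cases h2 : c = 0 ∧ a = 0
    · obtain ⟨rfl, rfl⟩ := h2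
      exact ⟨1, 0, by simp⟩
    · exact ⟨c, -a, by simpa using h2, by ring, by ring⟩
  · exact ⟨d, -b, by simpa using h1, by linear_combination h, by ring⟩

/-- If the subgroup generated by `x`, `z` and `T` is saturated at the prime `l`, then `l` does not
divide its index in the group generated by `ε₁`, `ε₂` and `T`. -/
theorem not_dvd_det_of_saturated (hx : x = e * (ε₁ ^ a * ε₂ ^ b))
    (hz : z = e' * (ε₁ ^ c * ε₂ ^ d)) (he : e ∈ T) (he' : e' ∈ T) (l : ℕ) [Fact l.Prime]
    (hl : ∀ t ∈ T, ∀ (m n : ℕ) (v : G), t * x ^ m * z ^ n = v ^ l → l ∣ m ∧ l ∣ n) :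
    ¬ (l : ℤ) ∣ a * d - b * c := by
  intro hdvd
  rw [← ZMod.intCast_zmod_eq_zero_iff_dvd] at hdvd
  push_cast at hdvd
  -- A kernel vector modulo l makes the exponents of ε₁ and ε₂ in x^m z^n divisible by l, so this is
  -- an l-th power up to `T`, against saturation.
  obtain ⟨m, n, hmn, h1, h2⟩ := exists_kernel_vector hdvd
  have hm : ((m.val : ℕ) : ZMod l) = m := ZMod.natCast_zmod_val m
  have hn : ((n.val : ℕ) : ZMod l) = n := ZMod.natCast_zmod_val n
  generalize m.val = m' at hm
  generalize n.val = n' at hn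
  subst hm hn
  have d1 : (l : ℤ) ∣ m' * a + n' * c := by
    rw [← ZMod.intCast_zmod_eq_zero_iff_dvd]; exact_mod_cast h1
  have d2 : (l : ℤ) ∣ m' * b + n' * d := by
    rw [← ZMod.intCast_zmod_eq_zero_iff_dvd]; exact_mod_cast h2
  obtain ⟨i, hi⟩ := d1
  obtain ⟨j, hj⟩ := d2
  have hpow : (e ^ m' * e' ^ n')⁻¹ * x ^ m' * z ^ n' = (ε₁ ^ i * ε₂ ^ j) ^ l := by
    have h3 : (ε₁ ^ i * ε₂ ^ j) ^ l = ε₁ ^ (l * i) * ε₂ ^ (l * j) := by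
      rw [mul_pow, ← zpow_natCast, ← zpow_natCast, ← zpow_mul, ← zpow_mul, mul_comm i, mul_comm j]
    rw [h3, ← hi, ← hj, hx, hz, zpow_add, zpow_add, mul_comm (m' : ℤ), mul_comm (m' : ℤ),
      mul_comm (n' : ℤ), mul_comm (n' : ℤ), zpow_mul, zpow_mul, zpow_mul, zpow_mul, zpow_natCast,
      zpow_natCast, zpow_natCast, zpow_natCast]
    simp only [mul_pow, mul_inv]
    rw [show ∀ p q r s t u : G, p⁻¹ * q⁻¹ * (p * (r * s)) * (q * (t * u)) =
      (p⁻¹ * p) * (q⁻¹ * q) * (r * t * (s * u)) from fun p q r s t u => by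
        simp only [mul_comm, mul_left_comm, mul_assoc]]
    simp
  obtain ⟨h4, h5⟩ := hl _ (T.inv_mem (T.mul_mem (T.pow_mem he _) (T.pow_mem he' _))) _ _ _ hpow
  exact hmn ⟨(ZMod.natCast_eq_zero_iff _ _).2 h4, (ZMod.natCast_eq_zero_iff _ _).2 h5⟩

/-- Elimination gives A^D = B^D = 1 with D = ad - bc, and D is prime to the exponent 6. -/
theorem eq_one_of_zpow_eq_one {H : Type*} [CommGroup H] {A B : H} (h1 : A ^ a * B ^ b = 1)
    (h2 : A ^ c * B ^ d = 1) (hA : A ^ 6 = 1) (hB : B ^ 6 = 1)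
    (hD : IsCoprime (a * d - b * c) 6) : A = 1 ∧ B = 1 := by
  have e : ∀ k, A ^ (a * k) = (B ^ (b * k))⁻¹ := fun k => eq_inv_of_mul_eq_one_left (by
    rw [zpow_mul, zpow_mul, ← mul_zpow, h1, one_zpow])
  have e' : ∀ k, A ^ (c * k) = (B ^ (d * k))⁻¹ := fun k => eq_inv_of_mul_eq_one_left (by
    rw [zpow_mul, zpow_mul, ← mul_zpow, h2, one_zpow])
  have hA' : A ^ (a * d - b * c) = 1 := by
    rw [zpow_sub, e, mul_comm b c, e', mul_comm d b, mul_inv_cancel]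
  have hB' : B ^ (a * d - b * c) = 1 := by
    rw [zpow_sub, mul_comm a d, ← inv_inv (B ^ (d * a)), ← inv_inv (B ^ (b * c)), ← e, ← e',
      mul_comm a c, mul_inv_cancel]
  obtain ⟨u, v, huv⟩ := hD
  have key : ∀ C : H, C ^ 6 = 1 → C ^ (a * d - b * c) = 1 → C = 1 := by
    intro C h6 hC
    have h6' : C ^ (6 : ℤ) = 1 := by exact_mod_cast h6
    rw [← zpow_one C, ← huv, zpow_add, mul_comm u, mul_comm v, zpow_mul, zpow_mul, hC, h6',
      one_zpow, one_zpow, mul_one]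
  exact ⟨key A hA hA', key B hB hB'⟩

/-- A character with values of order dividing `6` that is trivial on a subgroup of rank two
saturated at `2` and `3` is trivial. -/
theorem map_eq_one_of_saturated {H : Type*} [CommGroup H] (χ : G →* H)
    (hgen : ∀ u : G, ∃ t ∈ T, ∃ i j : ℤ, u = t * (ε₁ ^ i * ε₂ ^ j)) (hT : ∀ t ∈ T, χ t = 1)
    (h6 : ∀ u, χ u ^ 6 = 1) (hx : χ x = 1) (hz : χ z = 1)
    (hl : ∀ l : ℕ, l = 2 ∨ l = 3 → ∀ t ∈ T, ∀ (m n : ℕ) (v : G),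
      t * x ^ m * z ^ n = v ^ l → l ∣ m ∧ l ∣ n) (u : G) : χ u = 1 := by
  obtain ⟨e, he, a, b, hxe⟩ := hgen x
  obtain ⟨e', he', c, d, hze⟩ := hgen z
  have : Fact (Nat.Prime 2) := ⟨Nat.prime_two⟩
  have : Fact (Nat.Prime 3) := ⟨Nat.prime_three⟩
  have h2 := not_dvd_det_of_saturated hxe hze he he' 2 (hl 2 (Or.inl rfl))
  have h3 := not_dvd_det_of_saturated hxe hze he he' 3 (hl 3 (Or.inr rfl))
  have hcop : IsCoprime (a * d - b * c) 6 := by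
    have h2' := ((Int.prime_two.coprime_iff_not_dvd).2 (by exact_mod_cast h2)).symm
    have h3' := ((Int.prime_three.coprime_iff_not_dvd).2 (by exact_mod_cast h3)).symm
    exact h2'.mul_right h3'
  have e1 : χ ε₁ ^ a * χ ε₂ ^ b = 1 := by
    rw [← hx, hxe, map_mul, map_mul, map_zpow, map_zpow, hT e he, one_mul]
  have e2 : χ ε₁ ^ c * χ ε₂ ^ d = 1 := by
    rw [← hz, hze, map_mul, map_mul, map_zpow, map_zpow, hT e' he', one_mul]
  obtain ⟨hA, hB⟩ := eq_one_of_zpow_eq_one e1 e2 (h6 _) (h6 _) hcop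
  obtain ⟨t, ht, i, j, rfl⟩ := hgen u
  rw [map_mul, map_mul, map_zpow, map_zpow, hT t ht, hA, hB]
  simp

end Saturation

/-! ### Units of the maximal order have equal residues. -/

section Units

open NumberField Module

instance fact_prime_five : Fact (Nat.Prime 5) := ⟨by norm_num⟩

instance fact_prime_seven : Fact (Nat.Prime 7) := ⟨by norm_num⟩

instance fact_prime_thirteen : Fact (Nat.Prime 13) := ⟨by norm_num⟩

namespace IsCubicPair

variable {K : Type*} [Field K] [NumberField K] {y w : 𝓞 K} (h : IsCubicPair K y w)
include h

/-- The equation f(Θ) = 0 reads Θ(Θ - 1)(Θ - 26) = 1. -/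
theorem exists_units : ∃ x z : (𝓞 K)ˣ, (x : 𝓞 K) = y + 2 ∧ (z : 𝓞 K) = y + 1 := by
  have h1 : (y + 2) * ((y + 1) * (y - 24)) = 1 := by
    linear_combination (y - 21) * h.y_mul_y + 7 * h.y_mul_w
  exact ⟨Units.mkOfMulEqOne _ _ h1,
    Units.mkOfMulEqOne (y + 1) ((y + 2) * (y - 24)) (by linear_combination h1), rfl, rfl⟩

theorem exists_fundamental_units : ∃ ε₁ ε₂ : (𝓞 K)ˣ, ∀ u : (𝓞 K)ˣ,
    ∃ t ∈ Units.torsion K, ∃ i j : ℤ, u = t * (ε₁ ^ i * ε₂ ^ j) := by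
  have hr := h.units_rank_eq
  refine ⟨Units.fundSystem K (Fin.cast hr.symm 0), Units.fundSystem K (Fin.cast hr.symm 1), ?_⟩
  intro u
  obtain ⟨⟨t, g⟩, hu, -⟩ := Units.exist_unique_eq_mul_prod K u
  refine ⟨t, t.2, g (Fin.cast hr.symm 0), g (Fin.cast hr.symm 1), ?_⟩
  rw [hu]
  congr 1
  rw [← Fin.prod_univ_two (fun i : Fin 2 => Units.fundSystem K (Fin.cast hr.symm i) ^
    g (Fin.cast hr.symm i))]
  exact (Fintype.prod_equiv (finCongr hr.symm) _ _ (fun i => rfl)).symm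

theorem torsion_eq (t : (𝓞 K)ˣ) (ht : t ∈ Units.torsion K) : t = 1 ∨ t = -1 :=
  Units.torsion_eq_one_or_neg_one_of_odd_finrank (by rw [h.finrank_eq]; decide) ⟨t, ht⟩

theorem dvd_of_eq_pow {x z : (𝓞 K)ˣ} (hx : (x : 𝓞 K) = y + 2) (hz : (z : 𝓞 K) = y + 1) (l : ℕ)
    (hl : l = 2 ∨ l = 3) (t : (𝓞 K)ˣ) (ht : t ∈ Units.torsion K) (m n : ℕ) (v : (𝓞 K)ˣ)
    (hv : t * x ^ m * z ^ n = v ^ l) : l ∣ m ∧ l ∣ n := by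
  -- Raising to k = (p - 1)/l kills v^l by Fermat, and the evenness of k kills the sign `t`. What is
  -- left is a relation between l-th power residue symbols.
  have main : ∀ (p : ℕ) [Fact p.Prime] (f : 𝓞 K →+* ZMod p) (k : ℕ), Even k → l * k = p - 1 →
      ((f y + 2) ^ k) ^ m * ((f y + 1) ^ k) ^ n = 1 := by
    intro p _ f k hk hkp
    have h1 := congrArg (fun u : (𝓞 K)ˣ => f u ^ k) hv
    have ht' : f (t : 𝓞 K) ^ k = 1 := by
      rcases h.torsion_eq t ht with rfl | rfl
      · simp
      · simp [hk.neg_one_pow]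
    simp only [Units.val_mul, Units.val_pow_eq_pow_val, map_mul, map_pow, mul_pow] at h1
    rw [ht', one_mul, ← pow_mul (f v), hkp,
      ZMod.pow_card_sub_one_eq_one (v.isUnit.map f).ne_zero, hx, hz, map_add, map_add,
      map_ofNat, map_one, ← pow_mul, ← pow_mul, mul_comm m, mul_comm n, pow_mul, pow_mul] at h1
    exact h1
  obtain ⟨f13, hf13, -⟩ := h.exists_ringHom (9 : ZMod 13) 6 (by decide) (by decide) (by decide)
  rcases hl with rfl | rfl
  -- At 13, x is a nonsquare and z a square; at 5 it is the reverse, so each parity is read off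
  -- separately.
  · obtain ⟨f5, hf5, -⟩ := h.exists_ringHom (2 : ZMod 5) 2 (by decide) (by decide) (by decide)
    have h13 := main 13 f13 6 (by decide) rfl
    have h5 := main 5 f5 2 (by decide) rfl
    rw [hf13, show ((9 : ZMod 13) + 2) ^ 6 = -1 by decide,
      show ((9 : ZMod 13) + 1) ^ 6 = 1 by decide, one_pow, mul_one] at h13
    rw [hf5, show ((2 : ZMod 5) + 2) ^ 2 = 1 by decide,
      show ((2 : ZMod 5) + 1) ^ 2 = -1 by decide, one_pow, one_mul] at h5
    exact ⟨(neg_one_pow_eq_one_iff_even (by decide)).1 h13 |>.two_dvd,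
      (neg_one_pow_eq_one_iff_even (by decide)).1 h5 |>.two_dvd⟩
  -- At 7 the cubic symbol of z is trivial and that of x is not, giving 3 ∣ m; then 13 gives 3 ∣ n.
  · obtain ⟨f7, hf7, -⟩ := h.exists_ringHom (0 : ZMod 7) 0 (by decide) (by decide) (by decide)
    have h13 := main 13 f13 4 (by decide) rfl
    have h7 := main 7 f7 2 (by decide) rfl
    rw [hf13, show ((9 : ZMod 13) + 2) ^ 4 = 3 by decide,
      show ((9 : ZMod 13) + 1) ^ 4 = 3 by decide] at h13
    rw [hf7, show ((0 : ZMod 7) + 2) ^ 2 = 4 by decide,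
      show ((0 : ZMod 7) + 1) ^ 2 = 1 by decide, one_pow, mul_one] at h7
    have hm : 3 ∣ m := by
      rw [← orderOf_eq_prime (show (4 : ZMod 7) ^ 3 = 1 by decide) (by decide)]
      exact orderOf_dvd_of_pow_eq_one h7
    refine ⟨hm, ?_⟩
    obtain ⟨q, rfl⟩ := hm
    rw [pow_mul, show (3 : ZMod 13) ^ 3 = 1 by decide, one_pow, one_mul] at h13
    rw [← orderOf_eq_prime (show (3 : ZMod 13) ^ 3 = 1 by decide) (by decide)]
    exact orderOf_dvd_of_pow_eq_one h13

/-- Every unit has the same residue at the two primes above `7`. -/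
theorem unit_eq {φ ψ : 𝓞 K →+* ZMod 7} (hφ : φ y = 0) (hψ : ψ y = 0) (u : (𝓞 K)ˣ) :
    φ u = ψ u := by
  obtain ⟨ε₁, ε₂, hgen⟩ := h.exists_fundamental_units
  obtain ⟨x, z, hx, hz⟩ := h.exists_units
  let χ : (𝓞 K)ˣ →* (ZMod 7)ˣ := Units.map (φ : 𝓞 K →* ZMod 7) / Units.map (ψ : 𝓞 K →* ZMod 7)
  have hχ : ∀ v, χ v = 1 ↔ φ v = ψ v := by
    intro v
    change Units.map (φ : 𝓞 K →* ZMod 7) v / Units.map (ψ : 𝓞 K →* ZMod 7) v = 1 ↔ _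
    rw [div_eq_one, Units.ext_iff]
    rfl
  rw [← hχ]
  refine map_eq_one_of_saturated χ hgen ?_ (fun v => ZMod.units_pow_card_sub_one_eq_one 7 _)
    (x := x) (z := z) ?_ ?_ (fun l hl => h.dvd_of_eq_pow hx hz l hl) u
  · intro t ht
    rw [hχ]
    rcases h.torsion_eq t ht with rfl | rfl <;> simp
  · rw [hχ, hx, map_add, map_add, hφ, hψ, map_ofNat, map_ofNat]
  · rw [hχ, hz, map_add, map_add, hφ, hψ, map_one, map_one]

end IsCubicPair

end Units

/-! ### The field ℚ(Θ) and its integers y, w. -/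

section CubicField

open NumberField Module IntermediateField

theorem root_relation {Θ : ℂ} (hΘ : aeval Θ (csPoly 27) = 0) :
    Θ ^ 3 - 27 * Θ ^ 2 + 26 * Θ - 1 = 0 := by
  have := hΘ
  simp only [csPoly, map_sub, map_add, map_mul, map_pow, aeval_X, aeval_C, map_one] at this
  simp only [eq_intCast] at this
  push_cast at this
  linear_combination this

theorem not_root_rat (q : ℚ) : q ^ 3 - 27 * q ^ 2 + 26 * q - 1 ≠ 0 := by
  intro hq
  have hint : IsIntegral ℤ q := ⟨X ^ 3 - 27 * X ^ 2 + 26 * X - 1, by monicity!, by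
    rw [← hq]; simp⟩
  obtain ⟨n, rfl⟩ := IsIntegrallyClosed.isIntegral_iff.1 hint
  have hn : n * (n ^ 2 - 27 * n + 26) = 1 := by
    have : (n : ℚ) ^ 3 - 27 * n ^ 2 + 26 * n - 1 = 0 := by simpa using hq
    have h' : n ^ 3 - 27 * n ^ 2 + 26 * n - 1 = 0 := by exact_mod_cast this
    linear_combination h'
  rcases Int.eq_one_or_neg_one_of_mul_eq_one hn with rfl | rfl <;> norm_num at hn

theorem minpoly_eq {Θ : ℂ} (hΘ : aeval Θ (csPoly 27) = 0) :
    minpoly ℚ Θ = X ^ 3 - 27 * X ^ 2 + 26 * X - 1 := by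
  have hmonic : (X ^ 3 - 27 * X ^ 2 + 26 * X - 1 : ℚ[X]).Monic := by monicity!
  have hdeg : (X ^ 3 - 27 * X ^ 2 + 26 * X - 1 : ℚ[X]).natDegree = 3 := by compute_degree!
  have hirr : Irreducible (X ^ 3 - 27 * X ^ 2 + 26 * X - 1 : ℚ[X]) := by
    rw [hmonic.irreducible_iff_roots_eq_zero_of_degree_le_three (by rw [hdeg]; norm_num)
      (by rw [hdeg])]
    refine Multiset.eq_zero_of_forall_notMem fun q hq => ?_
    rw [mem_roots hmonic.ne_zero, IsRoot.def] at hq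
    exact not_root_rat q (by simpa using hq)
  exact (minpoly.eq_of_irreducible_of_monic hirr
    (by
      simp only [map_sub, map_add, map_mul, map_pow, aeval_X, map_ofNat, map_one]
      exact root_relation hΘ) hmonic).symm

theorem natDegree_minpoly {Θ : ℂ} (hΘ : aeval Θ (csPoly 27) = 0) :
    (minpoly ℚ Θ).natDegree = 3 := by
  rw [minpoly_eq hΘ]; compute_degree!

theorem isIntegral_root {Θ : ℂ} (hΘ : aeval Θ (csPoly 27) = 0) : IsIntegral ℤ Θ :=
  ⟨X ^ 3 - 27 * X ^ 2 + 26 * X - 1, by monicity!, by simpa using root_relation hΘ⟩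

theorem numberField_adjoin {Θ : ℂ} (hΘ : aeval Θ (csPoly 27) = 0) : NumberField ℚ⟮Θ⟯ :=
  have := adjoin.finiteDimensional (isIntegral_root hΘ).tower_top (K := ℚ)
  { to_charZero := inferInstance, to_finiteDimensional := this }

theorem quadratic_eq_zero {Θ : ℂ} (hΘ : aeval Θ (csPoly 27) = 0) (a b c : ℚ)
    (h : (a : ℂ) + b * (Θ - 2) + c * ((Θ - 2) ^ 2 / 7) = 0) : a = 0 ∧ b = 0 ∧ c = 0 := by
  set q : ℚ[X] := C a + C b * (X - 2) + C (c / 7) * (X - 2) ^ 2 with hq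
  have hq0 : q = 0 := by
    by_contra hne
    have h1 := natDegree_le_natDegree (minpoly.degree_le_of_ne_zero ℚ Θ hne (by
      rw [hq, ← h]
      simp only [map_sub, map_add, map_mul, map_pow, aeval_X, aeval_C, map_ofNat, eq_ratCast]
      push_cast
      ring))
    rw [natDegree_minpoly hΘ] at h1
    have h2 : q.natDegree ≤ 2 := by rw [hq]; compute_degree!
    omega
  -- The values at 2, 3, 1 are a and a ± b + c/7.
  have e1 := congrArg (eval 2) hq0
  have e2 := congrArg (eval 3) hq0
  have e3 := congrArg (eval 1) hq0
  simp [hq] at e1 e2 e3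
  refine ⟨e1, ?_, ?_⟩ <;> linarith

/-- The ring `ℤ[Θ]` inside the ring of integers of the field `ℚ(Θ)`. -/
theorem exists_isCubicPair {Θ : ℂ} (hΘ : aeval Θ (csPoly 27) = 0) [NumberField ℚ⟮Θ⟯] :
    ∃ (y w : 𝓞 ℚ⟮Θ⟯) (ι : ZAdjoin Θ →+* 𝓞 ℚ⟮Θ⟯), IsCubicPair ℚ⟮Θ⟯ y w ∧
      Function.Injective ι ∧ ι (gen Θ) = y + 2 := by
  have hrel := root_relation hΘ
  let θ : ℚ⟮Θ⟯ := AdjoinSimple.gen ℚ Θ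
  have hθ : (θ : ℂ) = Θ := AdjoinSimple.coe_gen ℚ Θ
  have hθrel : θ ^ 3 - 27 * θ ^ 2 + 26 * θ - 1 = 0 := by
    apply Subtype.ext
    push_cast
    rw [hθ]
    exact hrel
  have hyint : IsIntegral ℤ (θ - 2) := ⟨X ^ 3 - 21 * X ^ 2 - 70 * X - 49, by monicity!, by
    simp
    linear_combination hθrel⟩
  -- Integrality of y²/7 is what makes ℤ[Θ] non-maximal at 7.
  have hwint : IsIntegral ℤ ((θ - 2) ^ 2 / 7) := ⟨X ^ 3 - 83 * X ^ 2 + 58 * X - 7, by monicity!, by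
    simp
    linear_combination ((θ - 2) ^ 3 + 21 * (θ - 2) ^ 2 - 70 * (θ - 2) + 49) / 343 * hθrel⟩
  let y : 𝓞 ℚ⟮Θ⟯ := ⟨θ - 2, hyint⟩
  let w : 𝓞 ℚ⟮Θ⟯ := ⟨(θ - 2) ^ 2 / 7, hwint⟩
  have hy : (y : ℚ⟮Θ⟯) = θ - 2 := rfl
  have hw : (w : ℚ⟮Θ⟯) = (θ - 2) ^ 2 / 7 := rfl
  have hmem : ∀ r : ZAdjoin Θ, (r : ℂ) ∈ ℚ⟮Θ⟯ := by
    intro r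
    refine Algebra.adjoin_induction (p := fun x _ => x ∈ ℚ⟮Θ⟯) ?_ ?_ ?_ ?_ r.2
    · rintro x rfl
      exact mem_adjoin_simple_self ℚ x
    · intro n
      exact intCast_mem ℚ⟮Θ⟯ n
    · exact fun _ _ _ _ => add_mem
    · exact fun _ _ _ _ => mul_mem
  let j : ZAdjoin Θ →+* ℚ⟮Θ⟯ :=
    (Algebra.adjoin ℤ ({Θ} : Set ℂ)).val.toRingHom.codRestrict ℚ⟮Θ⟯ hmem
  have hj : ∀ r, ((j r : ℚ⟮Θ⟯) : ℂ) = r := fun r => rfl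
  have hjint : ∀ r, IsIntegral ℤ (j r) := by
    intro r
    have h1 : IsIntegral ℤ ((j r : ℚ⟮Θ⟯) : ℂ) := by
      rw [hj]
      exact adjoin_le_integralClosure (isIntegral_root hΘ) r.2
    exact (isIntegral_algHom_iff ((ℚ⟮Θ⟯.val).restrictScalars ℤ) Subtype.val_injective).1 h1
  let ι : ZAdjoin Θ →+* 𝓞 ℚ⟮Θ⟯ := j.codRestrict (integralClosure ℤ ℚ⟮Θ⟯) hjint
  have hι : ∀ r, ((ι r : 𝓞 ℚ⟮Θ⟯) : ℚ⟮Θ⟯) = j r := fun r => rfl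
  refine ⟨y, w, ι, ⟨?_, ?_, ?_, ?_, ?_⟩, ?_, ?_⟩
  · rw [adjoin.finrank (isIntegral_root hΘ).tower_top, natDegree_minpoly hΘ]
  · apply RingOfIntegers.ext
    simp only [map_mul, map_ofNat, hy, hw]
    ring
  · apply RingOfIntegers.ext
    simp only [map_mul, map_add, map_ofNat, hy, hw]
    linear_combination hθrel / 7
  · apply RingOfIntegers.ext
    simp only [map_mul, map_add, map_ofNat, hy, hw]
    linear_combination (θ - 2 + 21) / 49 * hθrel
  · intro a b c habc
    refine quadratic_eq_zero hΘ a b c ?_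
    rw [hy, hw] at habc
    have := congrArg (Subtype.val) habc
    push_cast at this
    rw [hθ] at this
    exact this
  · intro r s hrs
    apply Subtype.ext
    rw [← hj, ← hj, ← hι, ← hι, hrs]
  · apply RingOfIntegers.ext
    have hy2 : ((y + 2 : 𝓞 ℚ⟮Θ⟯) : ℚ⟮Θ⟯) = θ := by
      simp only [map_add, map_ofNat, hy]
      ring
    rw [hι, hy2]
    apply Subtype.ext
    rw [hj, hθ]
    rfl

end CubicField

/-! ### ℤ[Θ] as a glued ring, and the slopes of the seven ideals. -/

section Glueing

open NumberField

/-- On a + by + cw the maps ψ and φ differ by 3c, so they agree exactly when 7 ∣ c, that is on ℤ +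
ℤy + ℤy². -/
theorem IsCubicPair.isGlued {K : Type*} [Field K] [NumberField K] {y w : 𝓞 K}
    (h : IsCubicPair K y w) {Θ : ℂ} {ι : ZAdjoin Θ →+* 𝓞 K} (hι : Function.Injective ι)
    (hgen : ι (gen Θ) = y + 2) {φ ψ : 𝓞 K →+* ZMod 7} (hφy : φ y = 0) (hφw : φ w = 0)
    (hψy : ψ y = 0) (hψw : ψ w = 3) : IsGlued ι φ ψ where
  injective := hι
  surjective a b := by
    obtain ⟨a, rfl⟩ := ZMod.intCast_surjective a
    obtain ⟨c, hc⟩ := ZMod.intCast_surjective ((b - (a : ZMod 7)) / 3)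
    have h3 : (3 : ZMod 7) ≠ 0 := by decide
    refine ⟨a + c * w, by simp [hφw], ?_⟩
    rw [map_add, map_mul, map_intCast, map_intCast, hψw, hc, div_mul_cancel₀ _ h3]
    ring
  mem_range x := by
    constructor
    · intro hx
      obtain ⟨a, b, c, rfl⟩ := h.exists_coord x
      have hc : ((7 : ℕ) : ℤ) ∣ c := by
        rw [← ZMod.intCast_zmod_eq_zero_iff_dvd]
        simp only [map_add, map_mul, map_intCast, hφy, hφw, hψy, hψw, mul_zero, add_zero] at hx
        have h3 : (3 : ZMod 7) ≠ 0 := by decide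
        exact (mul_eq_zero.1 (left_eq_add.1 hx)).resolve_right h3
      obtain ⟨m, rfl⟩ := hc
      refine ⟨a + b * (gen Θ - 2) + m * (gen Θ - 2) ^ 2, ?_⟩
      simp only [map_add, map_mul, map_sub, map_pow, map_intCast, map_ofNat, hgen]
      push_cast
      linear_combination (m : 𝓞 K) * h.y_mul_y
    · rintro ⟨⟨r, hr⟩, rfl⟩
      refine Algebra.adjoin_induction (p := fun x hx => φ (ι ⟨x, hx⟩) = ψ (ι ⟨x, hx⟩))
        ?_ ?_ ?_ ?_ hr
      · rintro x rfl
        change φ (ι (gen x)) = ψ (ι (gen x))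
        rw [hgen, map_add, map_add, hφy, hψy, map_ofNat, map_ofNat]
      · intro n
        change φ (ι (algebraMap ℤ (ZAdjoin Θ) n)) = ψ (ι (algebraMap ℤ (ZAdjoin Θ) n))
        simp
      · intro x x' hx hx' e e'
        change φ (ι (⟨x, hx⟩ + ⟨x', hx'⟩)) = ψ (ι (⟨x, hx⟩ + ⟨x', hx'⟩))
        rw [map_add, map_add, map_add, e, e']
      · intro x x' hx hx' e e'
        change φ (ι (⟨x, hx⟩ * ⟨x', hx'⟩)) = ψ (ι (⟨x, hx⟩ * ⟨x', hx'⟩))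
        rw [map_mul, map_mul, map_mul, e, e']
  unit_eq := h.unit_eq hφy hψy

/-- The class monoid of `ℤ[Θ]` embeds into the multiplicative monoid of `ZMod 7`. -/
theorem exists_slopeHom_cls {Θ : ℂ} (hΘ : aeval Θ (csPoly 27) = 0) :
    ∃ g : IdealClassMonoid (ZAdjoin Θ) →* ZMod 7, Function.Injective g ∧
      ∀ i, g (cls Θ i) = ![0, 3, 2, 6, 4, 5, 1] i := by
  have := numberField_adjoin hΘ
  obtain ⟨y, w, ι, h, hι, hgen⟩ := exists_isCubicPair hΘ
  have := h.isPrincipalIdealRing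
  obtain ⟨φ, hφy, hφw⟩ := h.exists_ringHom (0 : ZMod 7) 0 (by decide) (by decide) (by decide)
  obtain ⟨ψ, hψy, hψw⟩ := h.exists_ringHom (0 : ZMod 7) 3 (by decide) (by decide) (by decide)
  have hG := h.isGlued hι hgen hφy hφw hψy hψw
  have hφ : ¬ Function.Injective φ := by
    intro hinj
    have h7 : ((7 : ℕ) : 𝓞 (IntermediateField.adjoin ℚ {Θ})) = 0 :=
      hinj (by rw [map_natCast, map_zero]; rfl)
    norm_num at h7
  obtain ⟨g, hg, hval⟩ := hG.exists_slopeHom hφ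
  have hmap : ∀ c d : ℤ, (pairIdeal Θ c d).map ι =
      Ideal.span {y - ((c - 2 : ℤ) : 𝓞 _), (d : 𝓞 (IntermediateField.adjoin ℚ {Θ}))} := by
    intro c d
    rw [pairIdeal, Ideal.map_span, Set.image_pair, map_sub, hgen, map_intCast, map_intCast]
    push_cast
    rw [show y + 2 - (c : 𝓞 (IntermediateField.adjoin ℚ {Θ})) = y - (c - 2) by ring]
  -- The ideal contains d, prime to 7, and π = k + ly + mw has φ π = k and ψ π = k + 3m, so the
  -- slope is k/(k + 3m).
  have hunit : ∀ (c d : ℤ) (hd : d ≠ 0) (π : 𝓞 (IntermediateField.adjoin ℚ {Θ})) (k l m : ℤ)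
      (t : ZMod 7),
      Ideal.span {y - ((c - 2 : ℤ) : 𝓞 _), (d : 𝓞 (IntermediateField.adjoin ℚ {Θ}))} =
        Ideal.span {π} → π = k + l * y + m * w → (d : ZMod 7) ≠ 0 →
      ((k + 3 * m : ℤ) : ZMod 7) ≠ 0 → (k : ZMod 7) = t * ((k + 3 * m : ℤ) : ZMod 7) →
      g (pairClass Θ c d hd) = t := by
    intro c d hd π k l m s hspan hklm hd7 hb0 hs
    have hφπ : φ π = k := by rw [hklm]; simp [hφy, hφw]
    have hψπ : ψ π = (k + 3 * m : ℤ) := by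
      rw [hklm]
      simp only [map_add, map_mul, map_intCast, hψy, hψw]
      push_cast
      ring
    have hπ : π ≠ 0 := by
      rintro rfl
      exact hb0 (by rw [← hψπ, map_zero])
    obtain ⟨t, ht⟩ := hG.exists_hasSlope hπ ((hmap c d).trans hspan)
    rw [pairClass, hval _ _ π t hπ ht, hG.slope_eq_div ht (r := (d : ZAdjoin Θ))
      (Ideal.subset_span (by simp)) (by rwa [map_intCast, map_intCast]) (by rwa [hψπ]), hφπ, hψπ,
      hs, mul_div_cancel_right₀ _ hb0]
  -- ⟨Θ - 2, 7⟩ is the conductor {7a + by + 7cw}, hence stable under `O`.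
  have hzero : g (pairClass Θ 2 7 (by decide)) = 0 := by
    obtain ⟨α, hα, t, ht⟩ := hG.exists_slope (pairIdeal_ne_bot Θ 2 7 (by decide))
    rw [pairClass, hval _ _ α t hα ht]
    refine hG.slope_eq_zero hα ht fun r hr x => ?_
    have hker : ∀ χ : 𝓞 (IntermediateField.adjoin ℚ {Θ}) →+* ZMod 7, χ y = 0 →
        χ (ι r) = 0 := by
      intro χ hχ
      have h1 : ι r ∈ (pairIdeal Θ 2 7).map ι := Ideal.mem_map_of_mem ι hr
      rw [hmap] at h1
      obtain ⟨u, v, e⟩ := Ideal.mem_span_pair.1 h1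
      rw [← e, map_add, map_mul, map_mul, map_sub, hχ, map_intCast, map_intCast]
      rw [show ((7 : ℤ) : ZMod 7) = 0 by decide]
      simp
    obtain ⟨a, b, c, e⟩ := h.exists_coord (ι r * x)
    have hφr : φ (ι r * x) = 0 := by rw [map_mul, hker φ hφy, zero_mul]
    have hψr : ψ (ι r * x) = 0 := by rw [map_mul, hker ψ hψy, zero_mul]
    rw [e] at hφr hψr
    simp only [map_add, map_mul, map_intCast, hφy, hφw, hψy, hψw, mul_zero, add_zero] at hφr hψr
    rw [hφr, zero_add] at hψr
    have hc := (mul_eq_zero.1 hψr).resolve_right (by decide)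
    obtain ⟨a, rfl⟩ := (ZMod.intCast_zmod_eq_zero_iff_dvd a 7).1 hφr
    obtain ⟨c, rfl⟩ := (ZMod.intCast_zmod_eq_zero_iff_dvd c 7).1 hc
    refine ⟨(b + c * (gen Θ - 2)) * (gen Θ - (2 : ℤ)) + a * (7 : ℤ), ?_, ?_⟩
    · exact Ideal.mem_span_pair.2 ⟨_, _, rfl⟩
    · rw [e]
      simp only [map_add, map_mul, map_sub, map_intCast, map_ofNat, hgen]
      push_cast
      linear_combination (c : 𝓞 (IntermediateField.adjoin ℚ {Θ})) * h.y_mul_y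
  -- For i ≥ 1 the slopes are the powers 3^i of the primitive root 3 modulo 7.
  refine ⟨g, hg, fun i => ?_⟩
  fin_cases i
  · exact hzero
  · exact hunit 7 17 (by decide) _ (-1) (-1) 1 3 (by push_cast; exact h.span_eq_seventeen)
      (by push_cast; ring) (by decide) (by decide) (by decide)
  · exact hunit 4 5 (by decide) _ (-1) (-1) (-1) 2 (by push_cast; exact h.span_eq_five)
      (by push_cast; ring) (by decide) (by decide) (by decide)
  · exact hunit 11 13 (by decide) _ (-2) (-2) (-1) 6 (by push_cast; exact h.span_eq_thirteen)
      (by push_cast; ring) (by decide) (by decide) (by decide)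
  · exact hunit 10 11 (by decide) _ (-1) 0 2 4 (by push_cast; exact h.span_eq_eleven)
      (by push_cast; ring) (by decide) (by decide) (by decide)
  · exact hunit 14 19 (by decide) _ (-2) (-2) 1 5 (by push_cast; exact h.span_eq_nineteen)
      (by push_cast; ring) (by decide) (by decide) (by decide)
  · exact hunit 1 1 (by decide) 1 1 0 0 1 (by
      rw [Int.cast_one, Ideal.span_singleton_one, Ideal.eq_top_iff_one]
      exact Ideal.subset_span (by simp)) (by simp) (by decide) (by decide) (by decide)

end Glueing

/-! ### Invertible classes as units, and the theorem. -/

/-- The classes of invertible ideals are the units of the ideal class monoid. -/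
theorem mem_picard_iff {R : Type*} [CommRing R] [IsDomain R] {x : IdealClassMonoid R} :
    x ∈ picard R ↔ IsUnit x := by
  constructor
  · intro hx
    exact (isUnit_picard ⟨x, hx⟩).map (picard R).subtype
  · intro hx
    obtain ⟨y, hxy⟩ := hx.exists_right_inv
    obtain ⟨⟨I, hI⟩, rfl⟩ := (idealCon R).mk'_surjective x
    obtain ⟨⟨J, hJ⟩, rfl⟩ := (idealCon R).mk'_surjective y
    obtain ⟨α, β, hα, hβ, e⟩ := (idealClass_eq_iff (hI := (nonzeroIdeals R).mul_mem hI hJ)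
      (hJ := one_ne_zero (α := Ideal R))).1 hxy
    refine ⟨I, hI, ⟨Ideal.span {α} * J, β, hβ, ?_⟩, rfl⟩
    rw [mul_left_comm, e, mul_one]

end IdealClasses

theorem mainTheorem8 (Θ : ℂ) (hΘ : Polynomial.aeval Θ (IdealClasses.csPoly 27) = 0) :
    -- the seven listed classes are pairwise distinct and exhaust `C(ℤ[Θ])`
    Nat.card (IdealClasses.IdealClassMonoid (IdealClasses.ZAdjoin Θ)) = 7 ∧
    Function.Bijective (IdealClasses.cls Θ) ∧
    -- the multiplication table
    (∀ i j : Fin 7, IdealClasses.cls Θ i * IdealClasses.cls Θ j =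
      IdealClasses.cls Θ (IdealClasses.mulTable i j)) ∧
    -- the Picard group consists of `I₁, …, I₆` and is cyclic of order 6, generated by `I₁`
    (IdealClasses.picard (IdealClasses.ZAdjoin Θ) :
        Set (IdealClasses.IdealClassMonoid (IdealClasses.ZAdjoin Θ))) =
      IdealClasses.cls Θ '' {i | i ≠ 0} ∧
    Nonempty (IdealClasses.picard (IdealClasses.ZAdjoin Θ) ≃* Multiplicative (ZMod 6)) ∧
    (∃ h : IdealClasses.pairClass Θ 7 17 (by decide) ∈
        IdealClasses.picard (IdealClasses.ZAdjoin Θ),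
      Subgroup.zpowers
        (⟨IdealClasses.pairClass Θ 7 17 (by decide), h⟩ :
          IdealClasses.picard (IdealClasses.ZAdjoin Θ)) = ⊤) ∧
    -- `⟨Θ - 2, 7⟩` is not invertible, and its class `I₀` is absorbing
    ¬ IdealClasses.IsInvertibleIdeal (IdealClasses.pairIdeal Θ 2 7) ∧
    (∀ x : IdealClasses.IdealClassMonoid (IdealClasses.ZAdjoin Θ),
      IdealClasses.pairClass Θ 2 7 (by decide) * x =
        IdealClasses.pairClass Θ 2 7 (by decide)) := by
  obtain ⟨g, hg, hval⟩ := IdealClasses.exists_slopeHom_cls hΘ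
  -- Through the injective `g`, the claims about the listed classes become finite checks in `ZMod
  -- 7`.
  have hinj : Function.Injective (IdealClasses.cls Θ) := by
    intro i j hij
    have := congrArg g hij
    rw [hval, hval] at this
    have key : ∀ i j : Fin 7, (![0, 3, 2, 6, 4, 5, 1] : Fin 7 → ZMod 7) i =
        (![0, 3, 2, 6, 4, 5, 1] : Fin 7 → ZMod 7) j → i = j := by
      decide
    exact key i j this
  have hsurj : Function.Surjective (IdealClasses.cls Θ) := by
    intro x
    have key : ∀ t : ZMod 7, ∃ i : Fin 7, (![0, 3, 2, 6, 4, 5, 1] : Fin 7 → ZMod 7) i = t := by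
      decide
    obtain ⟨i, hi⟩ := key (g x)
    exact ⟨i, hg ((hval i).trans hi)⟩
  have hmul : ∀ i j : Fin 7, IdealClasses.cls Θ i * IdealClasses.cls Θ j =
      IdealClasses.cls Θ (IdealClasses.mulTable i j) := by
    intro i j
    apply hg
    rw [map_mul, hval, hval, hval]
    revert i j
    decide
  have hpic : (IdealClasses.picard (IdealClasses.ZAdjoin Θ) :
      Set (IdealClasses.IdealClassMonoid (IdealClasses.ZAdjoin Θ))) =
      IdealClasses.cls Θ '' {i | i ≠ 0} := by
    ext x
    rw [SetLike.mem_coe, IdealClasses.mem_picard_iff]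
    constructor
    · intro hx
      obtain ⟨i, rfl⟩ := hsurj x
      refine ⟨i, ?_, rfl⟩
      rintro rfl
      have := (hx.map g).ne_zero
      rw [hval] at this
      exact this rfl
    · rintro ⟨i, hi, rfl⟩
      have key : ∀ i : Fin 7, i ≠ 0 → ∃ j : Fin 7, (![0, 3, 2, 6, 4, 5, 1] : Fin 7 → ZMod 7) i *
          (![0, 3, 2, 6, 4, 5, 1] : Fin 7 → ZMod 7) j = 1 := by
        decide
      obtain ⟨j, hj⟩ := key i hi
      exact IsUnit.of_mul_eq_one (IdealClasses.cls Θ j) (hg (by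
        rw [map_mul, hval, hval, hj, map_one]))
  have h1 : IdealClasses.pairClass Θ 7 17 (by decide) ∈
      IdealClasses.picard (IdealClasses.ZAdjoin Θ) := by
    rw [← SetLike.mem_coe, hpic]
    exact ⟨1, by decide, rfl⟩
  have hgen : ∀ x : IdealClasses.picard (IdealClasses.ZAdjoin Θ), x ∈ Subgroup.zpowers
      (⟨IdealClasses.pairClass Θ 7 17 (by decide), h1⟩ :
        IdealClasses.picard (IdealClasses.ZAdjoin Θ)) := by
    rintro ⟨x, hx⟩
    have hx' := hx
    rw [← SetLike.mem_coe, hpic] at hx'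
    obtain ⟨i, hi, rfl⟩ := hx'
    have key : ∀ i : Fin 7, i ≠ 0 → ∃ k : Fin 6,
        (3 : ZMod 7) ^ (k : ℕ) = (![0, 3, 2, 6, 4, 5, 1] : Fin 7 → ZMod 7) i := by
      decide
    obtain ⟨k, hk⟩ := key i hi
    have hpow : (⟨IdealClasses.pairClass Θ 7 17 (by decide), h1⟩ :
        IdealClasses.picard (IdealClasses.ZAdjoin Θ)) ^ (k : ℕ) =
          ⟨IdealClasses.cls Θ i, hx⟩ := by
      apply Subtype.ext
      change IdealClasses.cls Θ 1 ^ (k : ℕ) = IdealClasses.cls Θ i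
      apply hg
      rw [map_pow, hval, hval, ← hk]
      rfl
    rw [← hpow]
    exact Subgroup.npow_mem_zpowers _ _
  have hcard : Nat.card (IdealClasses.picard (IdealClasses.ZAdjoin Θ)) = 6 := by
    change Nat.card (IdealClasses.picard (IdealClasses.ZAdjoin Θ) :
      Set (IdealClasses.IdealClassMonoid (IdealClasses.ZAdjoin Θ))) = 6
    rw [hpic, Nat.card_image_of_injective hinj, Nat.card_eq_fintype_card]
    decide
  have hzero : g (IdealClasses.pairClass Θ 2 7 (by decide)) = 0 := hval 0
  refine ⟨?_, ⟨hinj, hsurj⟩, hmul, hpic, ?_, ⟨h1, (Subgroup.eq_top_iff' _).2 hgen⟩, ?_, ?_⟩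
  · rw [← Nat.card_eq_of_bijective _ ⟨hinj, hsurj⟩, Nat.card_eq_fintype_card, Fintype.card_fin]
  · have hcyc : IsCyclic (IdealClasses.picard (IdealClasses.ZAdjoin Θ)) := ⟨⟨_, hgen⟩⟩
    have e := zmodCyclicMulEquiv hcyc
    rw [hcard] at e
    exact ⟨e.symm⟩
  · intro hI
    have hmem : IdealClasses.pairClass Θ 2 7 (by decide) ∈
        IdealClasses.picard (IdealClasses.ZAdjoin Θ) := ⟨_, _, hI, rfl⟩
    rw [IdealClasses.mem_picard_iff] at hmem
    exact (hmem.map g).ne_zero hzero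
  · intro x
    apply hg
    rw [map_mul, hzero, zero_mul]
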